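/- Let $\mathbb H$ be a complex separable Hilbert space. For a compact operator $x$ on $\mathbb H$ let $s_0(x)\ge s_1(x)\ge\dots$ be its singular values, i.e. the eigenvalues of $|x|=(x^*x)^{1/2}$ in decreasing order, repeated according to multiplicity (and followed by zeros if $x$ has finite rank). Let $\mathrm{Tr}|x|=\sum_n s_n(x)$, and for a trace class operator $a$ let $\mathrm{Tr}(a)=\sum_k\langle e_k,ae_k\rangle$, for any orthonormal basis $(e_k)$. Let $\varphi:[0,\infty)\to[0,\infty]$ be an Orlicz function: convex, nondecreasing, continuous, $\varphi(0)=0$, $\varphi(u)>0$ for $u>0$, and $\varphi(u)\to\infty$ as $u\to\infty$. Let $\psi(u)=\sup_{v\ge0}(uv-\varphi(v))$ be its complementary function. For $\theta\in\{\varphi,\psi\}$ let $\theta^*(u)=\sup_{v\ge 0}(uv-\theta(v))$, and write $\mathrm{Tr}\,\theta(x)=\sum_n\theta(s_n(x))$ for compact $x$. Let $S_\theta$ (respectively $E_\theta$) be the space of the compact operators $x$ such that $\mathrm{Tr}\,\theta(cx)<\infty$ for some (respectively every) $c>0$. The Luxemburg norm is $\|x\|_\theta=\inf\{c>0:\mathrm{Tr}\,\theta(x/c)\le1\}$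 and the Orlicz norm is $\|x\|^o_\theta=\sup\{\mathrm{Tr}|xy| : y \text{ compact},\ \mathrm{Tr}\,\theta^*(y)\le1\}$. (a) Suppose that $\varphi$ is finite everywhere and that $\psi(v)>0$ for all $v>0$. Then, for all $x\in E_\varphi$ and $y\in S_\psi$, the operator $xy$ is of trace class; for every linear functional $L$ on $E_\varphi$ that is bounded with respect to $\|\cdot\|_\varphi$ there is a unique $y\in S_\psi$ with $L(x)=T_y(x):=\mathrm{Tr}(xy)$ for all $x\in E_\varphi$; and $y\mapsto T_y$ is an isometric linear isomorphism of $(S_\psi,\|\cdot\|^o_\psi)$ onto the dual of $(E_\varphi,\|\cdot\|_\varphi)$. (b) Suppose that $\psi$ is finite everywhere. Then, for all $x\in E_\psi$ and $y\in S_\varphi$, the operator $xy$ is of trace class; for every linear functional $L$ on $E_\psi$ that is bounded with respect to $\|\cdot\|^o_\psi$ there is a unique $y\in S_\varphi$ with $L(x)=\mathrm{Tr}(xy)$ for all $x\in E_\psi$; and $y\mapsto\mathrm{Tr}(\,\cdot\,y)$ is an isometric linear isomorphism of $(S_\varphi,\|\cdot\|_\varphi)$ onto the dual of $(E_\psi,\|\cdot\|^o_\psi)$.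 -/

import Mathlib

open Set Filter Topology
open scoped NNReal ENNReal

universe u

noncomputable section

namespace OperatorOrlicz

/-! ### Orlicz functions and complementary functions -/

/-- An Orlicz function: a convex, nondecreasing, continuous function `[0,∞) → [0,∞]` which vanishes
exactly at `0` and tends to infinity at infinity. -/
structure IsOrliczFunction (φ : ℝ≥0 → ℝ≥0∞) : Prop where
  convexOn : ConvexOn ℝ≥0 univ φ
  monotone : Monotone φ
  continuous : Continuous φ
  map_zero : φ 0 = 0
  pos : ∀ u, 0 < u → 0 < φ u
  tendsto_atTop : Tendsto φ atTop (𝓝 ∞)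

/-- The complementary function `ψ(u) = sup {uv - φ(v) : v ≥ 0}`. The truncated subtraction of
`[0,∞]` does not matter, because the term at `v = 0` is `0` as soon as `φ(0) = 0`. -/
def complementary (φ : ℝ≥0 → ℝ≥0∞) (u : ℝ≥0) : ℝ≥0∞ :=
  ⨆ v : ℝ≥0, ((u * v : ℝ≥0) : ℝ≥0∞) - φ v

/-- The two properties of a function `[0,∞) → [0,∞]` which make the sets `S_φ` and `E_φ` below
linear spaces; Orlicz functions and complementary functions have them. -/
structure IsGauge (φ : ℝ≥0 → ℝ≥0∞) : Prop where
  monotone : Monotone φ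
  map_zero : φ 0 = 0

theorem IsOrliczFunction.isGauge {φ : ℝ≥0 → ℝ≥0∞} (h : IsOrliczFunction φ) : IsGauge φ :=
  ⟨h.monotone, h.map_zero⟩

theorem isGauge_complementary (φ : ℝ≥0 → ℝ≥0∞) : IsGauge (complementary φ) where
  monotone := by
    intro a b hab
    refine iSup_mono fun v => tsub_le_tsub_right ?_ _
    exact_mod_cast mul_le_mul_left hab v
  map_zero := by simp [complementary]

variable {H : Type u} [NormedAddCommGroup H] [InnerProductSpace ℂ H] [CompleteSpace H]

/-! ### Singular values -/

/-- The span of the eigenvectors of `|x| = (x* x)^(1/2)` whose eigenvalue is larger than `t`.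
For `μ ≥ 0`, the eigenvectors of `|x|` for `μ` are those of `x* x` for `μ ^ 2`. -/
def spectralSpace (x : H →L[ℂ] H) (t : ℝ≥0) : Submodule ℂ H :=
  ⨆ μ : {μ : ℝ≥0 // t < μ},
    Module.End.eigenspace ((star x * x : H →L[ℂ] H) : Module.End ℂ H) (((μ : ℝ≥0) : ℂ) ^ 2)

/-- The singular values `s 0 ≥ s 1 ≥ …` of a compact operator `x`: the eigenvalues of `|x|`, in
decreasing order and repeated according to multiplicity (followed by zeros if `x` has finite rank).
Equivalently to listing them, `s n` is the least `t ≥ 0` such that at most `n` eigenvalues of `|x|`,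
counted with multiplicity, are larger than `t`. -/
def singularValue (x : H →L[ℂ] H) (n : ℕ) : ℝ≥0 :=
  sInf {t : ℝ≥0 | Module.rank ℂ (spectralSpace x t) ≤ (n : Cardinal)}

/-- `Tr φ(c x) = ∑ₙ φ(c sₙ(x))`, for `c ≥ 0`. -/
def modular (φ : ℝ≥0 → ℝ≥0∞) (c : ℝ≥0) (x : H →L[ℂ] H) : ℝ≥0∞ :=
  ∑' n, φ (c * singularValue x n)

/-! ### Trace -/

/-- `Tr |a| = ∑ₙ sₙ(a)`. -/
def traceNorm (a : H →L[ℂ] H) : ℝ≥0∞ :=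
  ∑' n, (singularValue a n : ℝ≥0∞)

/-- Trace class operators: compact operators with summable singular values. -/
def IsTraceClass (a : H →L[ℂ] H) : Prop :=
  IsCompactOperator a ∧ traceNorm a < ∞

/-- `a` is of trace class and `Tr a = t`: the series `∑ₖ ⟨eₖ, a eₖ⟩` converges (unconditionally,
hence absolutely) to `t` for every orthonormal basis `(eₖ)`. -/
def HasTrace (a : H →L[ℂ] H) (t : ℂ) : Prop :=
  IsTraceClass a ∧
    ∀ (ι : Type u) (e : HilbertBasis ι ℂ H),
      HasSum (fun k => @inner ℂ H InnerProductSpace.toInner (e k) (a (e k))) t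

/-! ### The two norms -/

/-- The Luxemburg norm `inf {c > 0 : Tr φ(x / c) ≤ 1}`. -/
def luxemburgNorm (φ : ℝ≥0 → ℝ≥0∞) (x : H →L[ℂ] H) : ℝ≥0∞ :=
  ⨅ (c : ℝ≥0) (_ : 0 < c) (_ : modular φ c⁻¹ x ≤ 1), (c : ℝ≥0∞)

/-- The Orlicz norm `sup {Tr |x y| : y compact, Tr ψ(y) ≤ 1}`, with `ψ` complementary to `φ`. -/
def orliczNorm (φ : ℝ≥0 → ℝ≥0∞) (x : H →L[ℂ] H) : ℝ≥0∞ :=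
  ⨆ (y : H →L[ℂ] H) (_ : IsCompactOperator y) (_ : modular (complementary φ) 1 y ≤ 1),
    traceNorm (x * y)

/-! ### Facts on singular values: they make `S_φ` and `E_φ` linear spaces -/

theorem isSymmetric_star_mul (x : H →L[ℂ] H) :
    ((star x * x : H →L[ℂ] H) : H →ₗ[ℂ] H).IsSymmetric := by
  intro v w
  simp [ContinuousLinearMap.star_eq_adjoint, ContinuousLinearMap.adjoint_inner_left,
    ContinuousLinearMap.adjoint_inner_right]

theorem inner_star_mul_self (x : H →L[ℂ] H) (v : H) :
    @inner ℂ H InnerProductSpace.toInner v ((star x * x : H →L[ℂ] H) v) = ((‖x v‖ ^ 2 : ℝ) : ℂ) := by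
  simp [ContinuousLinearMap.star_eq_adjoint, ContinuousLinearMap.adjoint_inner_right,
    inner_self_eq_norm_sq_to_K]

/-- On the orthogonal complement of the eigenvectors of `|x|` with eigenvalue larger than `t`,
the operator `x` is bounded by `t`. -/
theorem norm_apply_le {x : H →L[ℂ] H} (hx : IsCompactOperator x) (t : ℝ≥0) {v : H}
    (hv : v ∈ (spectralSpace x t)ᗮ) : ‖x v‖ ≤ t * ‖v‖ := by
  set A : H →L[ℂ] H := star x * x with hA
  have hAc : IsCompactOperator A := by
    have := hx.clm_comp (star x)
    simpa [hA] using this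
  have hAs : (A : H →ₗ[ℂ] H).IsSymmetric := isSymmetric_star_mul x
  have hinv : ∀ w ∈ (spectralSpace x t)ᗮ, (A : H →ₗ[ℂ] H) w ∈ (spectralSpace x t)ᗮ := by
    intro w hw
    rw [spectralSpace, ← Submodule.iInf_orthogonal] at hw ⊢
    rw [Submodule.mem_iInf] at hw ⊢
    exact fun μ => hAs.invariant_orthogonalComplement_eigenspace _ w (hw μ)
  let S : (spectralSpace x t)ᗮ →L[ℂ] (spectralSpace x t)ᗮ := A.restrict hinv
  have hS_compact : IsCompactOperator S := hAc.restrict' hinv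
  have hS_symm : S.IsSymmetric := hAs.restrict_invariant hinv
  have hSn : ‖S‖₊ ≤ t ^ 2 := by
    rw [← ENNReal.coe_le_coe, ← S.spectralRadius_eq_nnnorm hS_symm.isSelfAdjoint, spectralRadius]
    refine iSup₂_le fun k hk => ?_
    rcases eq_or_ne k 0 with rfl | hk0
    · simp
    rw [← hS_compact.hasEigenvalue_iff_mem_spectrum hk0] at hk
    obtain ⟨w, hw⟩ := hk.exists_hasEigenvector
    have hw1 : S w = k • w := hw.apply_eq_smul
    have hw2 : A (w : H) = k • (w : H) := congrArg Subtype.val hw1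
    have hw0 : (w : H) ≠ 0 := by simpa using hw.2
    have hin : inner ℂ (w : H) (A (w : H)) = ((‖x w‖ ^ 2 : ℝ) : ℂ) := inner_star_mul_self x w
    rw [hw2, inner_smul_right, inner_self_eq_norm_sq_to_K] at hin
    have hwn : (‖(w : H)‖ : ℂ) ≠ 0 := by simpa using hw0
    have hk1 : k = ((‖x w‖ / ‖(w : H)‖ : ℝ) : ℂ) ^ 2 := by
      push_cast at hin ⊢
      rw [div_pow, eq_div_iff (pow_ne_zero 2 hwn)]
      exact hin
    set m : ℝ≥0 := ‖x w‖₊ / ‖(w : H)‖₊ with hm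
    have hk2 : k = ((m : ℝ≥0) : ℂ) ^ 2 := by rw [hk1, hm]; simp
    have hmt : m ≤ t := by
      by_contra hlt
      push Not at hlt
      have h1 : (w : H) ∈ spectralSpace x t := by
        refine Submodule.mem_iSup_of_mem ⟨m, hlt⟩ ?_
        rw [Module.End.mem_eigenspace_iff, ← hk2]
        exact hw2
      exact hw0 (Submodule.disjoint_def.1 (Submodule.orthogonal_disjoint _) _ h1 w.2)
    have : ‖k‖₊ = m ^ 2 := by rw [hk2]; ext; simp
    rw [this]
    exact_mod_cast pow_le_pow_left₀ (zero_le (a := m)) hmt 2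
  have h1 : ((‖x v‖ ^ 2 : ℝ) : ℂ) = inner ℂ v (A v) := (inner_star_mul_self x v).symm
  have h2 : ‖x v‖ ^ 2 ≤ ‖v‖ * ‖A v‖ := by
    have := norm_inner_le_norm (𝕜 := ℂ) v (A v)
    rw [← h1] at this
    simpa using this
  have h3 : ‖A v‖ ≤ (t : ℝ) ^ 2 * ‖v‖ := by
    have h4 := S.le_opNorm ⟨v, hv⟩
    have h5 : ‖S‖ ≤ (t : ℝ) ^ 2 := by exact_mod_cast hSn
    have h6 : ‖S ⟨v, hv⟩‖ = ‖A v‖ := rfl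
    rw [h6] at h4
    exact h4.trans (mul_le_mul_of_nonneg_right h5 (norm_nonneg v))
  refine (sq_le_sq₀ (norm_nonneg _) (by positivity)).1 ?_
  nlinarith [norm_nonneg v]

theorem lt_norm_apply {x : H →L[ℂ] H} {t : ℝ≥0} {v : H} (hv : v ∈ spectralSpace x t)
    (hv0 : v ≠ 0) : t * ‖v‖ < ‖x v‖ := by
  classical
  have hAs : ((star x * x : H →L[ℂ] H) : H →ₗ[ℂ] H).IsSymmetric := isSymmetric_star_mul x
  have hO := hAs.orthogonalFamily_eigenspaces.comp
    (γ := {μ : ℝ≥0 // t < μ}) (f := fun μ => (((μ : ℝ≥0) : ℂ) ^ 2)) (by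
      intro a b hab
      have h : (((a : ℝ≥0) ^ 2 : ℝ≥0) : ℂ) = (((b : ℝ≥0) ^ 2 : ℝ≥0) : ℂ) := by
        push_cast; exact hab
      have h' : (a : ℝ≥0) ^ 2 = (b : ℝ≥0) ^ 2 := by exact_mod_cast h
      exact Subtype.ext (pow_left_injective two_ne_zero h'))
  obtain ⟨f, rfl⟩ := (Submodule.mem_iSup_iff_exists_dfinsupp' _ _).1 hv
  set g : H := f.sum fun _ w => (w : H) with hg
  have hgs : g = ∑ i ∈ f.support, ((f i : _) : H) := rfl
  have hn : ‖g‖ ^ 2 = ∑ i ∈ f.support, ‖f i‖ ^ 2 := by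
    rw [hgs]
    exact hO.norm_sum (fun i => f i) f.support
  have hxn : ‖x g‖ ^ 2 = ∑ i ∈ f.support, ((i : ℝ≥0) : ℝ) ^ 2 * ‖f i‖ ^ 2 := by
    have h1 := inner_star_mul_self x g
    have h2 : (star x * x : H →L[ℂ] H) g =
        ∑ i ∈ f.support, ((((i : ℝ≥0) : ℂ) ^ 2 • f i : _) : H) := by
      rw [hgs, map_sum]
      refine Finset.sum_congr rfl fun i _ => ?_
      exact Module.End.mem_eigenspace_iff.1 (f i).2
    have h3 := hO.inner_sum (fun i => f i) (fun i => ((i : ℝ≥0) : ℂ) ^ 2 • f i) f.support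
    have h4 : inner ℂ g ((star x * x : H →L[ℂ] H) g) =
        ∑ i ∈ f.support, inner ℂ (f i) (((i : ℝ≥0) : ℂ) ^ 2 • f i) := by
      rw [h2, hgs]; exact h3
    rw [h4] at h1
    have h5 : ((‖x g‖ ^ 2 : ℝ) : ℂ)
        = ((∑ i ∈ f.support, ((i : ℝ≥0) : ℝ) ^ 2 * ‖f i‖ ^ 2 : ℝ) : ℂ) := by
      rw [← h1]
      push_cast
      refine Finset.sum_congr rfl fun i _ => ?_
      change inner ℂ (f i : H) (((i : ℝ≥0) : ℂ) ^ 2 • (f i : H)) = _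
      rw [inner_smul_right, inner_self_eq_norm_sq_to_K]
      rfl
    exact_mod_cast h5
  have hne : f.support.Nonempty := by
    by_contra h
    rw [Finset.not_nonempty_iff_eq_empty] at h
    exact hv0 (by rw [hgs, h]; simp)
  refine (sq_lt_sq₀ (by positivity) (norm_nonneg _)).1 ?_
  rw [mul_pow, hn, hxn, Finset.mul_sum]
  refine Finset.sum_lt_sum_of_nonempty hne fun i hi => ?_
  have h6 : 0 < ‖f i‖ := norm_pos_iff.2 (DFinsupp.mem_support_iff.1 hi)
  have h7 : (t : ℝ) ^ 2 < ((i : ℝ≥0) : ℝ) ^ 2 := by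
    have : t ^ 2 < (i : ℝ≥0) ^ 2 := pow_lt_pow_left₀ i.2 (zero_le (a := t)) two_ne_zero
    exact_mod_cast this
  exact mul_lt_mul_of_pos_right h7 (by positivity)

/-- `s_n(x) ≤ t` as soon as `x` is bounded by `t` off a subspace of dimension at most `n`. -/
theorem singularValue_le {x : H →L[ℂ] H} {n : ℕ} {t : ℝ≥0} (V : Submodule ℂ H)
    (hV : Module.rank ℂ V ≤ (n : Cardinal)) (h : ∀ v ∈ Vᗮ, ‖x v‖ ≤ t * ‖v‖) :
    singularValue x n ≤ t := by
  have : FiniteDimensional ℂ V :=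
    Module.rank_lt_aleph0_iff.1 (hV.trans_lt (Cardinal.natCast_lt_aleph0))
  refine csInf_le (OrderBot.bddBelow _) (le_trans ?_ hV)
  refine LinearMap.rank_le_of_injective
    ((V.orthogonalProjectionOnto : H →ₗ[ℂ] V).comp (spectralSpace x t).subtype) ?_
  rw [← LinearMap.ker_eq_bot, LinearMap.ker_eq_bot']
  intro w hw
  by_contra hw0
  have hw1 : (w : H) ∈ Vᗮ := by
    rw [← Submodule.ker_orthogonalProjectionOnto]
    exact hw
  exact absurd (h _ hw1) (not_le.2 (lt_norm_apply w.2 (by simpa using hw0)))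

theorem singularValue_set_nonempty (x : H →L[ℂ] H) (n : ℕ) :
    {t : ℝ≥0 | Module.rank ℂ (spectralSpace x t) ≤ (n : Cardinal)}.Nonempty := by
  refine ⟨‖x‖₊, ?_⟩
  have : spectralSpace x ‖x‖₊ = ⊥ := by
    rw [Submodule.eq_bot_iff]
    intro v hv
    by_contra hv0
    exact absurd (x.le_opNorm v) (not_le.2 (lt_norm_apply hv hv0))
  rw [mem_ofPred_eq, this, rank_bot]
  exact zero_le

theorem exists_submodule {x : H →L[ℂ] H} (hx : IsCompactOperator x) {n : ℕ} {t : ℝ≥0}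
    (h : singularValue x n < t) : ∃ V : Submodule ℂ H,
      Module.rank ℂ V ≤ (n : Cardinal) ∧ ∀ v ∈ Vᗮ, ‖x v‖ ≤ t * ‖v‖ := by
  obtain ⟨s, hs, hst⟩ := exists_lt_of_csInf_lt (singularValue_set_nonempty x n) h
  refine ⟨_, hs, fun v hv => (norm_apply_le hx s hv).trans ?_⟩
  exact mul_le_mul_of_nonneg_right (by exact_mod_cast hst.le) (norm_nonneg v)

theorem singularValue_antitone (x : H →L[ℂ] H) : Antitone (singularValue x) := fun m _ hmn =>
  csInf_le_csInf (OrderBot.bddBelow _) (singularValue_set_nonempty x m)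
    fun _ ht => le_trans (mem_ofPred_eq ▸ ht) (Nat.cast_le.2 hmn)

theorem singularValue_add_le {x y : H →L[ℂ] H} (hx : IsCompactOperator x)
    (hy : IsCompactOperator y) (m n : ℕ) :
    singularValue (x + y) (m + n) ≤ singularValue x m + singularValue y n := by
  refine le_of_forall_pos_le_add fun ε hε => ?_
  obtain ⟨V, hV, hVx⟩ := exists_submodule hx (lt_add_of_pos_right (singularValue x m) (half_pos hε))
  obtain ⟨W, hW, hWy⟩ := exists_submodule hy (lt_add_of_pos_right (singularValue y n) (half_pos hε))
  refine singularValue_le (V ⊔ W) ?_ fun v hv => ?_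
  · refine (Submodule.rank_add_le_rank_add_rank V W).trans ?_
    push_cast
    exact add_le_add hV hW
  · have h1 := hVx v (Submodule.orthogonal_le le_sup_left hv)
    have h2 := hWy v (Submodule.orthogonal_le le_sup_right hv)
    have h3 : ‖(x + y) v‖ ≤ ‖x v‖ + ‖y v‖ := norm_add_le _ _
    refine h3.trans ((add_le_add h1 h2).trans (le_of_eq ?_))
    push_cast
    ring

theorem singularValue_smul_le {x : H →L[ℂ] H} (hx : IsCompactOperator x) (c : ℂ) (n : ℕ) :
    singularValue (c • x) n ≤ ‖c‖₊ * singularValue x n := by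
  have key : ∀ t, singularValue x n < t → singularValue (c • x) n ≤ ‖c‖₊ * t := by
    intro t ht
    obtain ⟨V, hV, hVx⟩ := exists_submodule hx ht
    refine singularValue_le V hV fun v hv => ?_
    have h1 := mul_le_mul_of_nonneg_left (hVx v hv) (norm_nonneg c)
    simpa [norm_smul, mul_assoc] using h1
  have hc : Tendsto (fun t => ‖c‖₊ * t) (𝓝[>] (singularValue x n))
      (𝓝 (‖c‖₊ * singularValue x n)) :=
    ((continuous_const.mul continuous_id).tendsto _).mono_left nhdsWithin_le_nhds
  exact ge_of_tendsto hc (eventually_nhdsWithin_of_forall key)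

theorem singularValue_zero (n : ℕ) : singularValue (0 : H →L[ℂ] H) n = 0 :=
  le_antisymm (singularValue_le ⊥ (by simp) (by simp)) (zero_le)

theorem modular_zero {φ : ℝ≥0 → ℝ≥0∞} (hφ : IsGauge φ) (c : ℝ≥0) :
    modular φ c (0 : H →L[ℂ] H) = 0 := by
  simp [modular, singularValue_zero, hφ.map_zero]

theorem modular_mono {φ : ℝ≥0 → ℝ≥0∞} (hφ : IsGauge φ) {c d : ℝ≥0} (h : c ≤ d) (x : H →L[ℂ] H) :
    modular φ c x ≤ modular φ d x :=
  ENNReal.tsum_le_tsum fun _ => hφ.monotone (mul_le_mul_left h _)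

theorem modular_smul_le {φ : ℝ≥0 → ℝ≥0∞} (hφ : IsGauge φ) {x : H →L[ℂ] H}
    (hx : IsCompactOperator x) (a : ℂ) (c : ℝ≥0) :
    modular φ c (a • x) ≤ modular φ (c * ‖a‖₊) x :=
  ENNReal.tsum_le_tsum fun _ => hφ.monotone (by
    rw [mul_assoc]; exact mul_le_mul_right (singularValue_smul_le hx a _) c)

theorem modular_add_le {φ : ℝ≥0 → ℝ≥0∞} (hφ : IsGauge φ) {x y : H →L[ℂ] H}
    (hx : IsCompactOperator x) (hy : IsCompactOperator y) (c : ℝ≥0) :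
    modular φ c (x + y) ≤ 2 * (modular φ (2 * c) x + modular φ (2 * c) y) := by
  have hsum : ∀ a b : ℝ≥0, φ (c * (a + b)) ≤ φ (2 * c * a) + φ (2 * c * b) := by
    intro a b
    rcases le_total a b with h | h
    · refine le_trans (hφ.monotone ?_) le_add_self
      rw [mul_comm 2 c, mul_assoc, two_mul]
      gcongr
    · refine le_trans (hφ.monotone ?_) le_self_add
      rw [mul_comm 2 c, mul_assoc, two_mul]
      gcongr
  have h0 : ∀ n, φ (c * singularValue (x + y) (n + n)) ≤
      φ (2 * c * singularValue x n) + φ (2 * c * singularValue y n) := fun n =>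
    (hφ.monotone (mul_le_mul_right (singularValue_add_le hx hy n n) c)).trans (hsum _ _)
  have h1 : ∀ n, φ (c * singularValue (x + y) (n + n + 1)) ≤
      φ (2 * c * singularValue x n) + φ (2 * c * singularValue y n) := fun n =>
    (hφ.monotone (mul_le_mul_right
      (singularValue_antitone _ (Nat.le_succ (n + n))) c)).trans (h0 n)
  rw [modular, ← tsum_even_add_odd ENNReal.summable ENNReal.summable, two_mul]
  simp only [two_mul (_ : ℕ)]
  refine add_le_add ?_ ?_
  · exact (ENNReal.tsum_le_tsum h0).trans ENNReal.tsum_add.le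
  · exact (ENNReal.tsum_le_tsum h1).trans ENNReal.tsum_add.le

/-! ### The spaces `S_φ` and `E_φ`, and their duals -/

/-- `S_φ`: the compact operators `x` such that `Tr φ(c x) < ∞` for some `c > 0`. -/
def orliczSpace (H : Type u) [NormedAddCommGroup H] [InnerProductSpace ℂ H] [CompleteSpace H]
    {φ : ℝ≥0 → ℝ≥0∞} (hφ : IsGauge φ) : Submodule ℂ (H →L[ℂ] H) where
  carrier := {x | IsCompactOperator x ∧ ∃ c : ℝ≥0, 0 < c ∧ modular φ c x < ∞}
  zero_mem' := ⟨isCompactOperator_zero, 1, one_pos, by simp [modular_zero hφ]⟩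
  add_mem' := by
    rintro x y ⟨hx, a, ha, hxa⟩ ⟨hy, b, hb, hyb⟩
    refine ⟨hx.add hy, min a b / 2, by positivity, (modular_add_le hφ hx hy _).trans_lt ?_⟩
    rw [mul_div_cancel₀ _ two_ne_zero]
    refine ENNReal.mul_lt_top (by simp) (ENNReal.add_lt_top.2 ⟨?_, ?_⟩)
    · exact (modular_mono hφ (min_le_left a b) x).trans_lt hxa
    · exact (modular_mono hφ (min_le_right a b) y).trans_lt hyb
  smul_mem' := by
    rintro a x ⟨hx, c, hc, hxc⟩
    refine ⟨hx.smul a, c / (‖a‖₊ + 1), by positivity, (modular_smul_le hφ hx a _).trans_lt ?_⟩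
    refine (modular_mono hφ ?_ x).trans_lt hxc
    rw [div_mul_eq_mul_div]
    refine div_le_of_le_mul₀ (by positivity) (by positivity) ?_
    gcongr
    exact le_self_add

/-- `E_φ`: the compact operators `x` such that `Tr φ(c x) < ∞` for all `c > 0`. -/
def orliczHeart (H : Type u) [NormedAddCommGroup H] [InnerProductSpace ℂ H] [CompleteSpace H]
    {φ : ℝ≥0 → ℝ≥0∞} (hφ : IsGauge φ) : Submodule ℂ (H →L[ℂ] H) where
  carrier := {x | IsCompactOperator x ∧ ∀ c : ℝ≥0, 0 < c → modular φ c x < ∞}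
  zero_mem' := ⟨isCompactOperator_zero, fun c _ => by simp [modular_zero hφ]⟩
  add_mem' := by
    rintro x y ⟨hx, hx'⟩ ⟨hy, hy'⟩
    refine ⟨hx.add hy, fun c hc => (modular_add_le hφ hx hy _).trans_lt ?_⟩
    exact ENNReal.mul_lt_top (by simp)
      (ENNReal.add_lt_top.2 ⟨hx' _ (by positivity), hy' _ (by positivity)⟩)
  smul_mem' := by
    rintro a x ⟨hx, hx'⟩
    refine ⟨hx.smul a, fun c hc => (modular_smul_le hφ hx a _).trans_lt ?_⟩
    exact (modular_mono hφ (by gcongr; exact le_self_add) x).trans_lt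
      (hx' (c * (‖a‖₊ + 1)) (by positivity))

/-- The dual of a space `E` of operators with respect to a norm `N`: the linear functionals `L` on
`E` with `|L(x)| ≤ C N(x)` for some finite constant `C`. -/
def boundedDual (E : Submodule ℂ (H →L[ℂ] H)) (N : (H →L[ℂ] H) → ℝ≥0∞) :
    Submodule ℂ (E →ₗ[ℂ] ℂ) where
  carrier := {L | ∃ C : ℝ≥0, ∀ x : E, ‖L x‖ₑ ≤ C * N x}
  zero_mem' := ⟨0, by simp⟩
  add_mem' := by
    rintro L M ⟨C, hC⟩ ⟨D, hD⟩
    refine ⟨C + D, fun x => (enorm_add_le (L x) (M x)).trans ?_⟩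
    push_cast
    rw [add_mul]
    exact add_le_add (hC x) (hD x)
  smul_mem' := by
    rintro a L ⟨C, hC⟩
    refine ⟨‖a‖₊ * C, fun x => ?_⟩
    rw [LinearMap.smul_apply, enorm_smul, ENNReal.coe_mul, mul_assoc]
    exact mul_le_mul_right (hC x) _

/-- The norm `sup {|L(x)| : x ∈ E, N(x) ≤ 1}` of a functional `L` on `(E, N)`. -/
def dualNorm {E : Submodule ℂ (H →L[ℂ] H)} (N : (H →L[ℂ] H) → ℝ≥0∞) (L : E →ₗ[ℂ] ℂ) : ℝ≥0∞ :=
  ⨆ (x : E) (_ : N x ≤ 1), ‖L x‖ₑ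

end OperatorOrlicz

end

set_option linter.unusedSectionVars false

namespace OperatorOrlicz

/-! ### Complementary functions -/

/-! Both halves are instances of one statement, `exists_linearEquiv_boundedDual`: `θ` and `θ'` are
complementary to each other, `θ` is finite, `θ'` is positive off zero, and `N` is a homogeneous
gauge with `N x ≤ 1 + Tr θ(x)`. The Luxemburg norm of `φ` and the Orlicz norm of `ψ` are such
gauges, and `φ` is its own biconjugate because a convex continuous function is the supremum of its
affine minorants.

The trace pairing rests on Hölder's inequality `Tr |xy| ≤ Tr θ(x) + Tr θ'(y)` (`traceNorm_mul_le`).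
Expanding `x` and `y` in Schmidt series, the products of matrix coefficients are dominated by a
doubly substochastic matrix (`exists_weight`), so Young's inequality may be summed entry by entry.

Conversely, a bounded functional `L` restricted to rank one operators is a bounded sesquilinear
form, hence is given by an operator `y`. Testing `L` on finite rank operators with free coefficients
`b i` gives `∑ c i * b i ≤ D (1 + ∑ θ(b i))`, where the `c i` are matrix coefficients of `y`; the
supremum over `b` is `∑ θ'(c i / D) ≤ 1` (`sum_complementary_le_one`). This forces `y` to be
compact, since otherwise arbitrarily many `c i` exceed a fixed `ε`, and then gives `Tr θ'(y / D) ≤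
1`. Finally `L` is determined by its values on rank one operators, because tails of Schmidt series
of elements of `E_θ` are small at every scale (`eq_zero_of_rankOne_eq_zero`).

For the isometry with the Orlicz norm, partial sums of `Tr |yx|` are traces of `y` against
truncations of `x` by partial isometries. For the one with the Luxemburg norm, the bound `Tr θ'(y /
D) ≤ 1` holds for every positive bound `D` of the functional. -/

theorem young (θ : ℝ≥0 → ℝ≥0∞) (a b : ℝ≥0) : (a * b : ℝ≥0∞) ≤ complementary θ a + θ b := by
  rw [← ENNReal.coe_mul]
  exact tsub_le_iff_right.1 (le_iSup (fun v : ℝ≥0 => ((a * v : ℝ≥0) : ℝ≥0∞) - θ v) b)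

/-- A supremum of affine functions is convex whatever `θ` is; here only `t * θ v ≤ θ v` is needed.
-/
theorem complementary_mul_le (θ : ℝ≥0 → ℝ≥0∞) {t : ℝ≥0} (ht : t ≤ 1) (u : ℝ≥0) :
    complementary θ (t * u) ≤ t * complementary θ u := by
  refine iSup_le fun v => ?_
  have h : ((u * v : ℝ≥0) : ℝ≥0∞) - θ v ≤ complementary θ u :=
    le_iSup (fun v : ℝ≥0 => ((u * v : ℝ≥0) : ℝ≥0∞) - θ v) v
  refine le_trans ?_ (mul_le_mul_right h _)
  rw [ENNReal.mul_sub fun _ _ => ENNReal.coe_ne_top, mul_assoc, ENNReal.coe_mul t]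
  refine tsub_le_tsub_left ?_ _
  calc (t : ℝ≥0∞) * θ v ≤ 1 * θ v := mul_le_mul_left (by exact_mod_cast ht) _
    _ = θ v := one_mul _

/-- The coordinates of `b` vary independently, so the sum of the suprema is the supremum over `b` of
the sums. -/
theorem sum_complementary_le {ι : Type*} {θ : ℝ≥0 → ℝ≥0∞} (hθ : IsGauge θ) (F : Finset ι)
    (a : ι → ℝ≥0)
    (h : ∀ b : ι → ℝ≥0, ∑ i ∈ F, (a i * b i : ℝ≥0∞) ≤ 1 + ∑ i ∈ F, θ (b i)) :
    ∑ i ∈ F, complementary θ (a i) ≤ 1 := by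
  classical
  let f : ι → (ι → ℝ≥0) → ℝ≥0∞ := fun i b => ((a i * b i : ℝ≥0) : ℝ≥0∞) - θ (b i)
  have h1 : ∀ i, complementary θ (a i) = ⨆ b : ι → ℝ≥0, f i b := fun i =>
    le_antisymm (iSup_le fun v => le_iSup (f i) fun _ => v)
      (iSup_le fun b => le_iSup (fun v : ℝ≥0 => ((a i * v : ℝ≥0) : ℝ≥0∞) - θ v) (b i))
  simp only [h1]
  rw [ENNReal.finsetSum_iSup]
  · refine iSup_le fun b => ?_
    -- A coordinate with `θ (b i) > a i * b i` contributes `0` to the truncated difference.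
    -- Replacing it by `0` makes every subtraction exact and every `θ (b' i)` finite, so that the
    -- sum of the latter can be cancelled.
    let b' : ι → ℝ≥0 := fun i => if θ (b i) ≤ ((a i * b i : ℝ≥0) : ℝ≥0∞) then b i else 0
    have h2 : ∀ i, f i b + θ (b' i) = a i * b' i := by
      intro i
      by_cases hi : θ (b i) ≤ ((a i * b i : ℝ≥0) : ℝ≥0∞)
      · have hb : b' i = b i := if_pos hi
        rw [hb, ← ENNReal.coe_mul]
        exact tsub_add_cancel_of_le hi
      · have hb : b' i = 0 := if_neg hi
        have hf : f i b = 0 := tsub_eq_zero_of_le (not_le.1 hi).le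
        simp [hb, hf, hθ.map_zero]
    have h3 := h b'
    simp only [← h2, Finset.sum_add_distrib] at h3
    refine (ENNReal.add_le_add_iff_right ?_).1 h3
    refine (ENNReal.sum_lt_top.2 fun i _ => ?_).ne
    refine lt_of_le_of_lt (le_add_self.trans (h2 i).le) ?_
    rw [← ENNReal.coe_mul]
    exact ENNReal.coe_lt_top
  -- Directedness, as required for exchanging sum and supremum: the better of the two values is
  -- taken in each coordinate.
  · intro b c
    refine ⟨fun i => if f i b ≤ f i c then c i else b i, fun i => ?_⟩
    by_cases hi : f i b ≤ f i c
    · have : f i (fun i => if f i b ≤ f i c then c i else b i) = f i c := by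
        simp only [f] at hi ⊢; rw [if_pos hi]
      rw [this]; exact ⟨hi, le_rfl⟩
    · have : f i (fun i => if f i b ≤ f i c then c i else b i) = f i b := by
        simp only [f] at hi ⊢; rw [if_neg hi]
      rw [this]; exact ⟨le_rfl, (not_le.1 hi).le⟩

theorem tsum_weight_mul_le {κ ι : Type*} {θ : ℝ≥0 → ℝ≥0∞} (w : κ → ι → ℝ≥0∞)
    (h₁ : ∀ k, ∑' i, w k i ≤ 1) (h₂ : ∀ i, ∑' k, w k i ≤ 1) (b : κ → ℝ≥0) (s : ι → ℝ≥0) :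
    ∑' k, ∑' i, w k i * (b k * s i) ≤ ∑' k, θ (b k) + ∑' i, complementary θ (s i) := by
  have h : ∀ k i, w k i * (b k * s i) ≤ w k i * θ (b k) + w k i * complementary θ (s i) := by
    intro k i
    rw [← mul_add, add_comm, mul_comm (b k : ℝ≥0∞)]
    exact mul_le_mul_right (young θ _ _) _
  calc ∑' k, ∑' i, w k i * (b k * s i)
      ≤ ∑' k, ∑' i, (w k i * θ (b k) + w k i * complementary θ (s i)) :=
        ENNReal.tsum_le_tsum fun k => ENNReal.tsum_le_tsum fun i => h k i
    _ = ∑' k, ∑' i, w k i * θ (b k) + ∑' k, ∑' i, w k i * complementary θ (s i) := by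
        simp only [ENNReal.tsum_add]
    _ ≤ _ := by
        refine add_le_add ?_ ?_
        · refine ENNReal.tsum_le_tsum fun k => ?_
          rw [ENNReal.tsum_mul_right]
          exact (mul_le_mul_left (h₁ k) _).trans (one_mul _).le
        · rw [ENNReal.tsum_comm]
          refine ENNReal.tsum_le_tsum fun i => ?_
          rw [ENNReal.tsum_mul_right]
          exact (mul_le_mul_left (h₂ i) _).trans (one_mul _).le

/-- Jensen's inequality for a substochastic matrix, read off from Young's inequality: each affine
function defining `complementary θ` passes through the weighted sum because the rows sum to at most
`1`. The column sums then control the total. -/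
theorem tsum_complementary_le {κ ι : Type*} {θ : ℝ≥0 → ℝ≥0∞} (w : κ → ι → ℝ≥0∞)
    (h₁ : ∀ k, ∑' i, w k i ≤ 1) (h₂ : ∀ i, ∑' k, w k i ≤ 1) (a : κ → ℝ≥0) (s : ι → ℝ≥0)
    (h : ∀ k, (a k : ℝ≥0∞) ≤ ∑' i, w k i * s i) :
    ∑' k, complementary θ (a k) ≤ ∑' i, complementary θ (s i) := by
  have key : ∀ k, complementary θ (a k) ≤ ∑' i, w k i * complementary θ (s i) := by
    intro k
    refine iSup_le fun b => ?_
    rw [tsub_le_iff_right, ENNReal.coe_mul]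
    calc (a k * b : ℝ≥0∞) ≤ (∑' i, w k i * s i) * b := mul_le_mul_left (h k) _
      _ = ∑' i, w k i * (s i * b) := by
        rw [← ENNReal.tsum_mul_right]; simp only [mul_assoc]
      _ ≤ ∑' i, (w k i * complementary θ (s i) + w k i * θ b) := by
        refine ENNReal.tsum_le_tsum fun i => ?_
        rw [← mul_add]
        exact mul_le_mul_right (young θ _ _) _
      _ ≤ _ := by
        rw [ENNReal.tsum_add, ENNReal.tsum_mul_right]
        gcongr
        exact (mul_le_mul_left (h₁ k) _).trans (one_mul _).le
  calc ∑' k, complementary θ (a k) ≤ ∑' k, ∑' i, w k i * complementary θ (s i) :=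
        ENNReal.tsum_le_tsum key
    _ = ∑' i, ∑' k, w k i * complementary θ (s i) := ENNReal.tsum_comm
    _ ≤ _ := by
        refine ENNReal.tsum_le_tsum fun i => ?_
        rw [ENNReal.tsum_mul_right]
        exact (mul_le_mul_left (h₂ i) _).trans (one_mul _).le

/-! ### Biconjugation. -/

/-- An affine minorant `w ↦ r + v (w - u)` of `φ` bounds `uv - ψ(v)` from below by `r`. -/
theorem le_complementary_complementary {φ : ℝ≥0 → ℝ≥0∞} (h₀ : φ 0 = 0)
    {u v r : ℝ≥0} (h : ∀ w : ℝ≥0, (r + v * w : ℝ≥0∞) ≤ φ w + u * v) :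
    (r : ℝ≥0∞) ≤ complementary (complementary φ) u := by
  refine le_trans ?_ (le_iSup (fun v : ℝ≥0 => ((u * v : ℝ≥0) : ℝ≥0∞) - complementary φ v) v)
  have h0 : (r : ℝ≥0∞) + complementary φ v ≤ ((u * v : ℝ≥0) : ℝ≥0∞) := by
    rw [complementary, ENNReal.add_iSup]
    refine iSup_le fun w => ?_
    have := h w
    rcases le_total (φ w) ((v * w : ℝ≥0) : ℝ≥0∞) with hw | hw
    · have hf : φ w ≠ ∞ := (hw.trans_lt ENNReal.coe_lt_top).ne
      rw [← ENNReal.add_le_add_iff_left hf, ENNReal.coe_mul, ← add_assoc, add_comm (φ w) (r : ℝ≥0∞),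
        add_assoc, ← ENNReal.coe_mul, add_tsub_cancel_of_le hw]
      simpa using this
    -- The truncated difference vanishes here, and what remains, `r ≤ u * v`, is the affine bound at
    -- `w = 0`.
    · rw [tsub_eq_zero_of_le hw, add_zero]
      simpa [h₀] using h 0
  exact ENNReal.le_sub_of_add_le_right (ne_top_of_le_ne_top ENNReal.coe_ne_top
    (le_add_self.trans h0)) h0

theorem IsOrliczFunction.toReal_mul_le {φ : ℝ≥0 → ℝ≥0∞} (h : IsOrliczFunction φ) {a m b : ℝ≥0}
    (ham : a < m) (hmb : m < b) (hb : φ b ≠ ∞) :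
    (φ m).toReal * (b - a) ≤ (φ a).toReal * (b - m) + (φ b).toReal * (m - a) := by
  have ha : φ a ≠ ∞ := ne_top_of_le_ne_top hb (h.monotone (ham.trans hmb).le)
  have hm : φ m ≠ ∞ := ne_top_of_le_ne_top hb (h.monotone hmb.le)
  have hab : 0 < b - a := tsub_pos_of_lt (ham.trans hmb)
  have e1 : ((b - a : ℝ≥0) : ℝ) = b - a := NNReal.coe_sub (ham.trans hmb).le
  have e2 : ((b - m : ℝ≥0) : ℝ) = b - m := NNReal.coe_sub hmb.le
  have e3 : ((m - a : ℝ≥0) : ℝ) = m - a := NNReal.coe_sub ham.le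
  have hab' : (0 : ℝ) < b - a := by rw [← e1]; exact_mod_cast hab
  have hsum : (b - m) / (b - a) + (m - a) / (b - a) = 1 := by
    ext
    push_cast [e1, e2, e3]
    field_simp
    ring
  have hcomb : ((b - m) / (b - a)) • a + ((m - a) / (b - a)) • b = m := by
    ext
    simp only [smul_eq_mul]
    push_cast [e1, e2, e3]
    field_simp
    ring
  have hc := h.convexOn.2 (mem_univ a) (mem_univ b) (zero_le (a := (b - m) / (b - a)))
    (zero_le (a := (m - a) / (b - a))) hsum
  rw [hcomb, ENNReal.smul_def, ENNReal.smul_def, smul_eq_mul, smul_eq_mul] at hc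
  have hr := ENNReal.toReal_mono (ENNReal.add_ne_top.2
    ⟨ENNReal.mul_ne_top ENNReal.coe_ne_top ha, ENNReal.mul_ne_top ENNReal.coe_ne_top hb⟩) hc
  rw [ENNReal.toReal_add (ENNReal.mul_ne_top ENNReal.coe_ne_top ha)
    (ENNReal.mul_ne_top ENNReal.coe_ne_top hb), ENNReal.toReal_mul, ENNReal.toReal_mul,
    ENNReal.coe_toReal, ENNReal.coe_toReal, NNReal.coe_div, NNReal.coe_div, e1, e2, e3] at hr
  calc (φ m).toReal * (b - a)
      ≤ ((b - m : ℝ) / (b - a) * (φ a).toReal + (m - a : ℝ) / (b - a) * (φ b).toReal) * (b - a) :=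
        mul_le_mul_of_nonneg_right hr hab'.le
    _ = _ := by field_simp

/-- The complementary function of the complementary function of `φ` is `φ`. -/
theorem IsOrliczFunction.complementary_complementary {φ : ℝ≥0 → ℝ≥0∞} (h : IsOrliczFunction φ) :
    complementary (complementary φ) = φ := by
  funext u
  refine le_antisymm (iSup_le fun v => ?_) ?_
  · rw [tsub_le_iff_right, mul_comm, ENNReal.coe_mul, add_comm]
    exact young φ v u
  rcases eq_or_ne u 0 with rfl | hu
  · simp [h.map_zero]
  refine ENNReal.le_of_forall_nnreal_lt fun r hr => ?_
  -- Continuity gives `u' < u` with `r < φ u'`. A line of height `r` at `u` then has room below `φ`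
  -- on `[u', u]` for any slope `v ≥ 0`, so no tangent is needed.
  obtain ⟨l, hl, hls⟩ := exists_Ioc_subset_of_mem_nhds
    (h.continuous.continuousAt.eventually (lt_mem_nhds hr)) ⟨0, pos_iff_ne_zero.2 hu⟩
  obtain ⟨u', hlu', hu'⟩ := exists_between hl
  have hru' : (r : ℝ≥0∞) < φ u' := hls ⟨hlu', hu'.le⟩
  have hpos : 0 < u - u' := tsub_pos_of_lt hu'
  have e1 : ((u - u' : ℝ≥0) : ℝ) = u - u' := NNReal.coe_sub hu'.le
  have hpos' : (0 : ℝ) < u - u' := by rw [← e1]; exact_mod_cast hpos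
  have hmid : ∀ v w : ℝ≥0, u' ≤ w → w ≤ u → (r + v * w : ℝ≥0∞) ≤ φ w + u * v := by
    intro v w h1 h2
    rw [mul_comm (u : ℝ≥0∞)]
    exact add_le_add (hru'.le.trans (h.monotone h1)) (mul_le_mul_right (by exact_mod_cast h2) _)
  by_cases hfin : φ u = ∞
  -- The line through `(u', 0)` and `(u, r)`: nonpositive left of `u'`, while `φ` is infinite right
  -- of `u`.
  · refine le_complementary_complementary h.map_zero (v := r / (u - u')) fun w => ?_
    rcases le_total w u' with hw | hw
    · refine le_trans ?_ le_add_self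
      have : r + r / (u - u') * w ≤ u * (r / (u - u')) := by
        rw [← NNReal.coe_le_coe]
        push_cast [e1]
        rw [← sub_nonneg]
        have hww : (w : ℝ) ≤ u' := by exact_mod_cast hw
        have : (u : ℝ) * (r / (u - u')) - (r + r / (u - u') * w) = r * (u' - w) / (u - u') := by
          field_simp
          ring
        rw [this]
        exact div_nonneg (mul_nonneg r.2 (by linarith)) hpos'.le
      exact_mod_cast this
    rcases le_total w u with hw' | hw'
    · exact hmid _ w hw hw'
    · have : φ w = ∞ := top_le_iff.1 (hfin ▸ h.monotone hw')
      simp [this]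
  · have hfin' : φ u' ≠ ∞ := ne_top_of_le_ne_top hfin (h.monotone hu'.le)
    have hP : (r : ℝ) < (φ u').toReal := by
      rwa [← ENNReal.coe_toReal, ENNReal.toReal_lt_toReal ENNReal.coe_ne_top hfin']
    have hPU : (φ u').toReal ≤ (φ u).toReal := ENNReal.toReal_mono hfin (h.monotone hu'.le)
    -- The slope of the secant of `φ` through `u'` and `u`; outside `[u', u]` convexity keeps `φ`
    -- above this secant.
    set v : ℝ≥0 := ((φ u).toReal - (φ u').toReal).toNNReal / (u - u') with hv
    have hv' : (v : ℝ) * (u - u') = (φ u).toReal - (φ u').toReal := by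
      rw [hv, NNReal.coe_div, e1, Real.coe_toNNReal _ (sub_nonneg.2 hPU)]
      field_simp
    have hreal : ∀ w : ℝ≥0, φ w ≠ ∞ → (r + v * w : ℝ) ≤ (φ w).toReal + u * v →
        (r + v * w : ℝ≥0∞) ≤ φ w + u * v := by
      intro w hw hle
      lift φ w to ℝ≥0 using hw with W
      exact_mod_cast hle
    refine le_complementary_complementary h.map_zero (v := v) fun w => ?_
    rcases lt_or_ge w u' with hw | hw
    · refine hreal w (ne_top_of_le_ne_top hfin' (h.monotone hw.le)) ?_
      have h1 := h.toReal_mul_le hw hu' hfin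
      have hww : (w : ℝ) < u' := by exact_mod_cast hw
      have h2 : 0 ≤ (u - u' : ℝ) * ((φ w).toReal + u * v - (φ u).toReal - v * w) := by
        have : (u - u' : ℝ) * ((φ w).toReal + u * v - (φ u).toReal - v * w) =
            (u - u') * ((φ w).toReal - (φ u).toReal) + (v * (u - u')) * (u - w) := by ring
        rw [this, hv']
        linarith
      have h3 := nonneg_of_mul_nonneg_right h2 hpos'
      linarith
    rcases le_or_gt w u with hw' | hw'
    · exact hmid v w hw hw'
    · by_cases hwt : φ w = ∞
      · simp [hwt]
      refine hreal w hwt ?_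
      have h1 := h.toReal_mul_le hu' hw' hwt
      have hww : (u : ℝ) < w := by exact_mod_cast hw'
      have h2 : 0 ≤ (u - u' : ℝ) * ((φ w).toReal + u * v - (φ u).toReal - v * w) := by
        have : (u - u' : ℝ) * ((φ w).toReal + u * v - (φ u).toReal - v * w) =
            (u - u') * ((φ w).toReal - (φ u).toReal) + (v * (u - u')) * (u - w) := by ring
        rw [this, hv']
        linarith
      have h3 := nonneg_of_mul_nonneg_right h2 hpos'
      linarith

/-! ### Schmidt decompositions -/

section Schmidt

variable {H : Type u} [NormedAddCommGroup H] [InnerProductSpace ℂ H] [CompleteSpace H]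

/-- `x = ∑ᵢ sᵢ ⟨eᵢ, ·⟩ fᵢ` with orthonormal families `e` and `f`. -/
structure IsSchmidt {ι : Type*} (x : H →L[ℂ] H) (s : ι → ℝ≥0) (e f : ι → H) : Prop where
  left : Orthonormal ℂ e
  right : Orthonormal ℂ f
  hasSum : ∀ v, HasSum (fun i => ((s i : ℂ) * inner ℂ (e i) v) • f i) (x v)

/-- `v` is a unit eigenvector of `x* x` in the orthogonal complement of `V` at which `x` attains
its norm on that complement, and `x v ≠ 0`. -/
structure IsMaxVector (x : H →L[ℂ] H) (V : Submodule ℂ H) (v : H) : Prop where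
  mem : v ∈ Vᗮ
  norm_eq : ‖v‖ = 1
  apply_eq : (star x * x : H →L[ℂ] H) v = ((‖x v‖ : ℂ) ^ 2) • v
  pos : 0 < ‖x v‖
  le : ∀ w ∈ Vᗮ, ‖x w‖ ≤ ‖x v‖ * ‖w‖

/-- The restriction of `x* x` to `Vᗮ` is compact and self-adjoint. Its norm equals its spectral
radius, which is attained at a nonzero spectral value, hence at an eigenvalue. -/
theorem exists_isMaxVector {x : H →L[ℂ] H} (hx : IsCompactOperator x) {V : Submodule ℂ H}
    (hV : ∀ w ∈ V, (star x * x : H →L[ℂ] H) w ∈ V) (hne : ∃ w ∈ Vᗮ, x w ≠ 0) :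
    ∃ v, IsMaxVector x V v := by
  set A : H →L[ℂ] H := star x * x with hA
  have hAc : IsCompactOperator A := by
    have := hx.clm_comp (star x)
    simpa [hA] using this
  have hAs : (A : H →ₗ[ℂ] H).IsSymmetric := isSymmetric_star_mul x
  have hinv : ∀ w ∈ Vᗮ, (A : H →ₗ[ℂ] H) w ∈ Vᗮ := by
    intro w hw
    rw [Submodule.mem_orthogonal] at hw ⊢
    intro u hu
    have h1 : inner ℂ u (A w) = inner ℂ (A u) w := (hAs u w).symm
    exact h1.trans (hw _ (hV u hu))
  let S : Vᗮ →L[ℂ] Vᗮ := A.restrict hinv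
  have hS_compact : IsCompactOperator S := hAc.restrict' hinv
  have hS_symm : S.IsSymmetric := hAs.restrict_invariant hinv
  obtain ⟨w₀, hw₀, hxw₀⟩ := hne
  have hAw : ∀ w ∈ Vᗮ, ‖x w‖ ^ 2 ≤ ‖S‖ * ‖w‖ ^ 2 := by
    intro w hw
    have h1 : ((‖x w‖ ^ 2 : ℝ) : ℂ) = inner ℂ w (A w) := (inner_star_mul_self x w).symm
    have h2 : ‖x w‖ ^ 2 ≤ ‖w‖ * ‖A w‖ := by
      have := norm_inner_le_norm (𝕜 := ℂ) w (A w)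
      rw [← h1] at this
      simpa using this
    have h4 := S.le_opNorm ⟨w, hw⟩
    have h6 : ‖S ⟨w, hw⟩‖ = ‖A w‖ := rfl
    have h7 : ‖(⟨w, hw⟩ : Vᗮ)‖ = ‖w‖ := rfl
    rw [h6, h7] at h4
    nlinarith [norm_nonneg w]
  have hSpos : 0 < ‖S‖ := by
    by_contra hle
    have h0 : ‖S‖ = 0 := le_antisymm (not_lt.1 hle) (norm_nonneg S)
    have := hAw w₀ hw₀
    rw [h0, zero_mul] at this
    exact hxw₀ (norm_eq_zero.1 (pow_eq_zero_iff two_ne_zero |>.1 (le_antisymm this (by positivity))))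
  have : Nontrivial Vᗮ := by
    refine ⟨⟨⟨w₀, hw₀⟩, 0, fun h => hxw₀ ?_⟩⟩
    have : w₀ = 0 := congrArg Subtype.val h
    simp [this]
  obtain ⟨k, hk, hkS⟩ := spectrum.exists_nnnorm_eq_spectralRadius S
  rw [S.spectralRadius_eq_nnnorm hS_symm.isSelfAdjoint, ENNReal.coe_inj] at hkS
  have hkn : ‖k‖ = ‖S‖ := congrArg NNReal.toReal hkS
  have hk0 : k ≠ 0 := by
    rintro rfl
    simp only [norm_zero] at hkn
    exact hSpos.ne hkn
  rw [← hS_compact.hasEigenvalue_iff_mem_spectrum hk0] at hk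
  obtain ⟨w, hw⟩ := hk.exists_hasEigenvector
  have hw2 : A (w : H) = k • (w : H) := congrArg Subtype.val hw.apply_eq_smul
  have hw0 : ‖(w : H)‖ ≠ 0 := by simpa using hw.2
  set v : H := ((‖(w : H)‖ : ℂ)⁻¹) • (w : H) with hv
  have hv1 : ‖v‖ = 1 := by
    rw [hv, norm_smul]
    simp [hw0]
  have hvV : v ∈ Vᗮ := Submodule.smul_mem _ _ w.2
  have hAv : A v = k • v := by rw [hv, map_smul, hw2, smul_comm]
  have hkv : k = (‖x v‖ : ℂ) ^ 2 := by
    have h1 : inner ℂ v (A v) = ((‖x v‖ ^ 2 : ℝ) : ℂ) := inner_star_mul_self x v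
    rw [hAv, inner_smul_right, inner_self_eq_norm_sq_to_K, hv1] at h1
    simpa using h1
  have hxv : ‖x v‖ ^ 2 = ‖S‖ := by rw [← hkn, hkv]; simp
  refine ⟨v, hvV, hv1, by rw [← hkv]; exact hAv, ?_, fun w hw => ?_⟩
  · refine (norm_nonneg _).lt_of_ne fun h => ?_
    rw [← h] at hxv
    simp only [ne_eq, OfNat.ofNat_ne_zero, not_false_eq_true, zero_pow] at hxv
    exact hSpos.ne hxv
  · refine (sq_le_sq₀ (norm_nonneg _) (by positivity)).1 ?_
    rw [mul_pow, hxv]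
    exact hAw w hw

/-! ### Greedy choice of eigenvectors. -/

open Classical in
/-- An eigenvector as in `IsMaxVector`, or `0` if there is none. -/
noncomputable def maxVector (x : H →L[ℂ] H) (V : Submodule ℂ H) : H :=
  if h : ∃ v, IsMaxVector x V v then h.choose else 0

/-- The span of the first `n` eigenvectors of `x* x`, chosen greedily. -/
noncomputable def maxSpan (x : H →L[ℂ] H) : ℕ → Submodule ℂ H
  | 0 => ⊥
  | n + 1 => maxSpan x n ⊔ Submodule.span ℂ {maxVector x (maxSpan x n)}

/-- The `n`-th eigenvector of `x* x`, chosen greedily. -/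
noncomputable def singularVector (x : H →L[ℂ] H) (n : ℕ) : H := maxVector x (maxSpan x n)

theorem isMaxVector_or (x : H →L[ℂ] H) (V : Submodule ℂ H) :
    IsMaxVector x V (maxVector x V) ∨ (¬ ∃ v, IsMaxVector x V v) ∧ maxVector x V = 0 := by
  by_cases h : ∃ v, IsMaxVector x V v
  · left; rw [maxVector, dif_pos h]; exact h.choose_spec
  · right; exact ⟨h, by rw [maxVector, dif_neg h]⟩

theorem star_mul_singularVector (x : H →L[ℂ] H) (n : ℕ) :
    (star x * x : H →L[ℂ] H) (singularVector x n) =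
      ((‖x (singularVector x n)‖ : ℂ) ^ 2) • singularVector x n := by
  rcases isMaxVector_or x (maxSpan x n) with h | h
  · exact h.apply_eq
  · rw [singularVector, h.2]; simp

theorem singularVector_mem_orthogonal (x : H →L[ℂ] H) (n : ℕ) :
    singularVector x n ∈ (maxSpan x n)ᗮ := by
  rcases isMaxVector_or x (maxSpan x n) with h | h
  · exact h.mem
  · rw [singularVector, h.2]; exact zero_mem _

theorem maxSpan_mono (x : H →L[ℂ] H) : Monotone (maxSpan x) :=
  monotone_nat_of_le_succ fun _ => le_sup_left

theorem singularVector_mem_maxSpan (x : H →L[ℂ] H) {m n : ℕ} (h : m < n) :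
    singularVector x m ∈ maxSpan x n :=
  maxSpan_mono x (Nat.succ_le_of_lt h)
    (Submodule.mem_sup_right (Submodule.mem_span_singleton_self _))

theorem star_mul_mem_maxSpan (x : H →L[ℂ] H) (n : ℕ) :
    ∀ w ∈ maxSpan x n, (star x * x : H →L[ℂ] H) w ∈ maxSpan x n := by
  induction n with
  | zero =>
    intro w hw
    rw [maxSpan, Submodule.mem_bot] at hw
    rw [hw, map_zero]
    exact zero_mem _
  | succ n ih =>
    intro w hw
    obtain ⟨a, ha, b, hb, rfl⟩ := Submodule.mem_sup.1 hw
    obtain ⟨c, rfl⟩ := Submodule.mem_span_singleton.1 hb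
    rw [map_add, map_smul]
    refine add_mem (Submodule.mem_sup_left (ih a ha)) (Submodule.smul_mem _ _ ?_)
    have h := star_mul_singularVector x n
    rw [singularVector] at h
    rw [h]
    exact Submodule.smul_mem _ _
      (Submodule.mem_sup_right (Submodule.mem_span_singleton_self _))

theorem rank_maxSpan_le (x : H →L[ℂ] H) (n : ℕ) : Module.rank ℂ (maxSpan x n) ≤ n := by
  induction n with
  | zero => rw [maxSpan, rank_bot]; exact zero_le
  | succ n ih =>
    refine (Submodule.rank_add_le_rank_add_rank _ _).trans ?_
    push_cast
    refine add_le_add ih ((rank_span_le _).trans ?_)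
    simp

theorem mem_orthogonal_maxSpan {x : H →L[ℂ] H} {w : H}
    (h : ∀ n, inner ℂ (singularVector x n) w = 0) (n : ℕ) : w ∈ (maxSpan x n)ᗮ := by
  induction n with
  | zero => simp [maxSpan]
  | succ n ih =>
    rw [maxSpan, ← Submodule.inf_orthogonal]
    refine ⟨ih, ?_⟩
    exact Submodule.mem_orthogonal_singleton_iff_inner_right.2 (h n)

/-- If the greedy choice has stopped, `x` vanishes on the complement, so the bound survives with the
default vector `0`. -/
theorem norm_le_norm_singularVector {x : H →L[ℂ] H} (hx : IsCompactOperator x) {n : ℕ} {w : H}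
    (hw : w ∈ (maxSpan x n)ᗮ) : ‖x w‖ ≤ ‖x (singularVector x n)‖ * ‖w‖ := by
  rcases isMaxVector_or x (maxSpan x n) with h | h
  · exact h.le w hw
  · have : x w = 0 := by
      by_contra hne
      exact h.1 (exists_isMaxVector hx (star_mul_mem_maxSpan x n) ⟨w, hw, hne⟩)
    rw [this, norm_zero]
    positivity

theorem norm_singularVector {x : H →L[ℂ] H} {n : ℕ} (h : x (singularVector x n) ≠ 0) :
    ‖singularVector x n‖ = 1 := by
  rcases isMaxVector_or x (maxSpan x n) with h' | h'
  · exact h'.norm_eq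
  · rw [singularVector, h'.2, map_zero] at h
    exact absurd rfl h

theorem inner_singularVector (x : H →L[ℂ] H) {m n : ℕ} (h : m ≠ n) :
    inner ℂ (singularVector x m) (singularVector x n) = 0 := by
  rcases lt_or_gt_of_ne h with h | h
  · exact singularVector_mem_orthogonal x n _ (singularVector_mem_maxSpan x h)
  · rw [inner_eq_zero_symm]
    exact singularVector_mem_orthogonal x m _ (singularVector_mem_maxSpan x h)

theorem singularVector_mem_spectralSpace {x : H →L[ℂ] H} {n : ℕ} {t : ℝ≥0}
    (h : t < ‖x (singularVector x n)‖₊) : singularVector x n ∈ spectralSpace x t := by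
  refine Submodule.mem_iSup_of_mem ⟨_, h⟩ ?_
  rw [Module.End.mem_eigenspace_iff]
  exact star_mul_singularVector x n

theorem norm_apply_singularVector_antitone {x : H →L[ℂ] H} (hx : IsCompactOperator x) {m n : ℕ}
    (h : m ≤ n) : ‖x (singularVector x n)‖ ≤ ‖x (singularVector x m)‖ := by
  by_cases h0 : x (singularVector x n) = 0
  · rw [h0, norm_zero]; positivity
  have h1 := norm_le_norm_singularVector hx (n := m) (w := singularVector x n)
    (Submodule.orthogonal_le (maxSpan_mono x h) (singularVector_mem_orthogonal x n))
  rwa [norm_singularVector h0, mul_one] at h1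

/-- A larger value would put `n + 1` orthonormal vectors in a spectral space of dimension at most
`n`. For the other inequality, `maxSpan x n` is a test space for `singularValue_le`. -/
theorem nnnorm_apply_singularVector {x : H →L[ℂ] H} (hx : IsCompactOperator x) (n : ℕ) :
    ‖x (singularVector x n)‖₊ = singularValue x n := by
  refine le_antisymm ?_ (singularValue_le (maxSpan x n) (rank_maxSpan_le x n) fun v hv => ?_)
  · by_contra hlt
    push Not at hlt
    obtain ⟨t, ht, htr⟩ := exists_lt_of_csInf_lt (singularValue_set_nonempty x n) hlt
    have hr : ∀ m : Fin (n + 1), t < ‖x (singularVector x m)‖₊ := fun m =>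
      htr.trans_le (norm_apply_singularVector_antitone hx (Nat.lt_succ_iff.1 m.2))
    have hne : ∀ m : Fin (n + 1), x (singularVector x m) ≠ 0 := fun m h0 => by
      have := hr m
      simp [h0] at this
    have ho : Orthonormal ℂ fun m : Fin (n + 1) =>
        (⟨_, singularVector_mem_spectralSpace (hr m)⟩ : spectralSpace x t) :=
      ⟨fun m => norm_singularVector (hne m), fun a b hab =>
        inner_singularVector x fun h => hab (Fin.ext h)⟩
    have hc := ho.linearIndependent.cardinal_lift_le_rank
    rw [Cardinal.lift_mk_fin, Cardinal.lift_uzero] at hc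
    have h1 := hc.trans ht
    exact absurd (Nat.cast_le.1 h1) (by omega)
  · exact norm_le_norm_singularVector hx hv

theorem inner_apply_singularVector (x : H →L[ℂ] H) {m n : ℕ} (h : m ≠ n) :
    inner ℂ (x (singularVector x m)) (x (singularVector x n)) = 0 := by
  have h1 : inner ℂ (singularVector x m) ((star x * x : H →L[ℂ] H) (singularVector x n)) =
      inner ℂ (x (singularVector x m)) (x (singularVector x n)) := by
    simp [ContinuousLinearMap.star_eq_adjoint, ContinuousLinearMap.adjoint_inner_right]
  rw [← h1, star_mul_singularVector, inner_smul_right, inner_singularVector x h, mul_zero]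

/-- Otherwise the images of the singular vectors are pairwise orthogonal of norm at least `ε`, hence
at mutual distance at least `ε`, inside a compact set. -/
theorem tendsto_singularValue {x : H →L[ℂ] H} (hx : IsCompactOperator x) :
    ∀ ε : ℝ≥0, 0 < ε → ∃ n, singularValue x n < ε := by
  intro ε hε
  by_contra hcon
  push Not at hcon
  have hr : ∀ n, (ε : ℝ) ≤ ‖x (singularVector x n)‖ := fun n => by
    have := hcon n
    rw [← nnnorm_apply_singularVector hx] at this
    exact_mod_cast this
  have hεr : (0 : ℝ) < ε := hε
  have hne : ∀ n, x (singularVector x n) ≠ 0 := fun n h0 => by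
    have := hr n
    rw [h0, norm_zero] at this
    linarith
  have hmem : ∀ n, x (singularVector x n) ∈ closure (x '' Metric.closedBall 0 1) := fun n =>
    subset_closure ⟨_, by simp [norm_singularVector (hne n)], rfl⟩
  obtain ⟨a, -, g, hg, hlim⟩ :=
    (hx.isCompact_closure_image_closedBall 1).tendsto_subseq hmem
  have hcau := hlim.cauchySeq
  rw [Metric.cauchySeq_iff'] at hcau
  obtain ⟨N, hN⟩ := hcau ε hεr
  have h1 := hN (N + 1) (Nat.le_succ N)
  rw [dist_eq_norm] at h1
  have hgne : g (N + 1) ≠ g N := (hg (Nat.lt_succ_self N)).ne'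
  have h3 : ‖x (singularVector x (g (N + 1))) - x (singularVector x (g N))‖ ^ 2 =
      ‖x (singularVector x (g (N + 1)))‖ ^ 2 + ‖x (singularVector x (g N))‖ ^ 2 := by
    rw [@norm_sub_sq ℂ, inner_apply_singularVector x hgne]
    simp
  have h4 := hr (g (N + 1))
  have h5 : ‖x (singularVector x (g (N + 1))) - x (singularVector x (g N))‖ < ε := h1
  nlinarith [norm_nonneg (x (singularVector x (g (N + 1))) - x (singularVector x (g N))),
    sq_nonneg ‖x (singularVector x (g N))‖]

/-- The Schmidt decomposition of a compact operator. -/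
theorem exists_isSchmidt {x : H →L[ℂ] H} (hx : IsCompactOperator x) :
    ∃ e f : {n // singularValue x n ≠ 0} → H, 
      IsSchmidt x (fun n : {n // singularValue x n ≠ 0} => singularValue x n) e f := by
  have hs : ∀ n, ‖x (singularVector x n)‖ = singularValue x n := fun n =>
    congrArg NNReal.toReal (nnnorm_apply_singularVector hx n)
  have hne : ∀ n : {n // singularValue x n ≠ 0}, x (singularVector x n) ≠ 0 := fun n h0 => by
    refine n.2 ?_
    rw [← nnnorm_apply_singularVector hx, h0, nnnorm_zero]
  have hsc : ∀ n : {n // singularValue x n ≠ 0}, ((singularValue x n : ℝ≥0) : ℂ) ≠ 0 := fun n => by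
    simpa using n.2
  set e : {n // singularValue x n ≠ 0} → H := fun n => singularVector x n with he
  have he_on : Orthonormal ℂ e := ⟨fun n => norm_singularVector (hne n), fun a b hab =>
    inner_singularVector x fun h => hab (Subtype.ext h)⟩
  refine ⟨e, fun n => ((singularValue x n : ℝ≥0) : ℂ)⁻¹ • x (singularVector x n), he_on,
    ⟨fun n => ?_, fun a b hab => ?_⟩, fun v => ?_⟩
  · rw [norm_smul, hs]
    have := n.2
    simp [this]
  · beta_reduce
    rw [inner_smul_left, inner_smul_right,
      inner_apply_singularVector x fun h => hab (Subtype.ext h)]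
    simp
  obtain ⟨w, b, hw, hb⟩ := Orthonormal.exists_hilbertBasis_extension
    (𝕜 := ℂ) (s := range e) he_on.toSubtypeRange
  have h1 : HasSum (fun i => x (b.repr v i • b i)) (x v) := (b.hasSum_repr v).mapL x
  let g : {n // singularValue x n ≠ 0} → w := fun n => ⟨e n, hw (mem_range_self n)⟩
  have hg : Function.Injective g := fun m n hmn =>
    he_on.linearIndependent.injective (congrArg Subtype.val hmn)
  -- A basis vector outside the family `e` is orthogonal to all singular vectors, so `x` is bounded
  -- on it by every singular value, and these become arbitrarily small.
  have h2 : ∀ i ∉ range g, x (b.repr v i • b i) = 0 := by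
    intro i hi
    have hperp : ∀ n, inner ℂ (singularVector x n) (b i) = 0 := by
      intro n
      by_cases hn : singularValue x n = 0
      -- When `s_n = 0` the singular vector is the default `0`, as a genuine `IsMaxVector` is not
      -- killed by `x`.
      · have hz : x (singularVector x n) = 0 := by
          rw [← nnnorm_eq_zero, nnnorm_apply_singularVector hx, hn]
        have : singularVector x n = 0 := by
          rcases isMaxVector_or x (maxSpan x n) with h | h
          · exact absurd hz (norm_pos_iff.1 h.pos)
          · exact h.2
        rw [this, inner_zero_left]
      · have hgb : b (g ⟨n, hn⟩) = singularVector x n := by rw [hb]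
        rw [← hgb]
        exact b.orthonormal.2 fun h => hi ⟨_, h⟩
    have hle : ∀ n, ‖x (b i)‖ ≤ singularValue x n := fun n => by
      have h := norm_le_norm_singularVector hx (mem_orthogonal_maxSpan hperp n)
      rwa [b.orthonormal.1 i, mul_one, hs] at h
    have hxz : x (b i) = 0 := by
      by_contra h0
      obtain ⟨n, hn⟩ := tendsto_singularValue hx ‖x (b i)‖₊ (nnnorm_pos.2 h0)
      exact absurd (hle n) (not_le.2 hn)
    rw [map_smul, hxz, smul_zero]
  refine ((hg.hasSum_iff h2).2 h1).congr_fun ?_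
  intro n
  have hgb : b (g n) = e n := by rw [hb]
  simp only [Function.comp_apply, HilbertBasis.repr_apply_apply, hgb, map_smul]
  rw [smul_smul]
  congr 1
  field_simp [hsc n]

end Schmidt

section Pairing

variable {H : Type u} [NormedAddCommGroup H] [InnerProductSpace ℂ H] [CompleteSpace H]
  {ι κ : Type*}

/-! ### Matrix coefficients of contractions -/

theorem tsum_enorm_inner_sq_le {e : ι → H} (he : Orthonormal ℂ e) (v : H) :
    ∑' i, ‖inner ℂ (e i) v‖ₑ ^ 2 ≤ ‖v‖ₑ ^ 2 := by
  rw [ENNReal.tsum_eq_iSup_sum]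
  refine iSup_le fun F => ?_
  have h : ∑ i ∈ F, ‖inner ℂ (e i) v‖₊ ^ 2 ≤ ‖v‖₊ ^ 2 := by
    rw [← NNReal.coe_le_coe]
    push_cast
    exact he.sum_inner_products_le v
  simp only [enorm_eq_nnnorm]
  exact_mod_cast h

theorem enorm_apply_sq_le_one {u : H →L[ℂ] H} (hu : ‖u‖ ≤ 1) {v : H} (hv : ‖v‖ = 1) :
    ‖u v‖ₑ ^ 2 ≤ 1 := by
  have h : ‖u v‖ ≤ 1 := by
    have := u.le_of_opNorm_le hu v
    rwa [hv, mul_one] at this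
  have h' : ‖u v‖₊ ≤ 1 := h
  rw [enorm_eq_nnnorm]
  exact_mod_cast pow_le_one₀ (zero_le (a := ‖u v‖₊)) h'

theorem tsum_enorm_inner_apply_sq_le_left {e : κ → H} {g : H} (he : Orthonormal ℂ e)
    (hg : ‖g‖ = 1) {u : H →L[ℂ] H} (hu : ‖u‖ ≤ 1) : ∑' k, ‖inner ℂ (e k) (u g)‖ₑ ^ 2 ≤ 1 :=
  (tsum_enorm_inner_sq_le he _).trans (enorm_apply_sq_le_one hu hg)

theorem tsum_enorm_inner_apply_sq_le_right {e : H} {g : ι → H} (he : ‖e‖ = 1)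
    (hg : Orthonormal ℂ g) {u : H →L[ℂ] H} (hu : ‖u‖ ≤ 1) :
    ∑' i, ‖inner ℂ e (u (g i))‖ₑ ^ 2 ≤ 1 := by
  have h := tsum_enorm_inner_apply_sq_le_left (e := g) (g := e) hg he
    (u := ContinuousLinearMap.adjoint u) (by rwa [LinearIsometryEquiv.norm_map])
  refine le_trans (le_of_eq (tsum_congr fun i => ?_)) h
  rw [ContinuousLinearMap.adjoint_inner_right, ← inner_conj_symm e, RCLike.enorm_conj]

/-- Products of matrix coefficients of contractions are dominated by a doubly substochastic
matrix. -/
theorem exists_weight {e : κ → H} {g : ι → H} {p : κ → H} {q : ι → H} (he : Orthonormal ℂ e)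
    (hg : Orthonormal ℂ g) (hp : Orthonormal ℂ p) (hq : Orthonormal ℂ q) {u v : H →L[ℂ] H}
    (hu : ‖u‖ ≤ 1) (hv : ‖v‖ ≤ 1) :
    ∃ w : κ → ι → ℝ≥0∞, (∀ k, ∑' i, w k i ≤ 1) ∧ (∀ i, ∑' k, w k i ≤ 1) ∧
      ∀ k i, ‖inner ℂ (e k) (u (g i))‖ₑ * ‖inner ℂ (q i) (v (p k))‖ₑ ≤ w k i := by
  have half : ∀ a b : ℝ≥0∞, a ≤ 1 → b ≤ 1 → 2⁻¹ * (a + b) ≤ 1 := by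
    intro a b ha hb
    calc 2⁻¹ * (a + b) ≤ 2⁻¹ * (1 + 1) := by gcongr
      _ = 1 := by rw [one_add_one_eq_two]; exact ENNReal.inv_mul_cancel (by simp) (by simp)
  -- The weights come from `a * b ≤ (a ^ 2 + b ^ 2) / 2`; Bessel's inequality bounds the sums of
  -- squares along rows and columns.
  refine ⟨fun k i => 2⁻¹ * (‖inner ℂ (e k) (u (g i))‖ₑ ^ 2 + ‖inner ℂ (q i) (v (p k))‖ₑ ^ 2),
    fun k => ?_, fun i => ?_, fun k i => ?_⟩
  · rw [ENNReal.tsum_mul_left, ENNReal.tsum_add]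
    exact half _ _ (tsum_enorm_inner_apply_sq_le_right (he.1 k) hg hu)
      (tsum_enorm_inner_apply_sq_le_left hq (hp.1 k) hv)
  · rw [ENNReal.tsum_mul_left, ENNReal.tsum_add]
    exact half _ _ (tsum_enorm_inner_apply_sq_le_left he (hg.1 i) hu)
      (tsum_enorm_inner_apply_sq_le_right (hq.1 i) hp hv)
  · simp only [enorm_eq_nnnorm]
    generalize ‖inner ℂ (e k) (u (g i))‖₊ = a
    generalize ‖inner ℂ (q i) (v (p k))‖₊ = b
    have h : a * b ≤ 2⁻¹ * (a ^ 2 + b ^ 2) := by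
      rw [← NNReal.coe_le_coe]
      push_cast
      nlinarith [sq_nonneg ((a : ℝ) - b)]
    have h2 : ((2⁻¹ : ℝ≥0) : ℝ≥0∞) = 2⁻¹ := by rw [ENNReal.coe_inv two_ne_zero]; rfl
    rw [← h2]
    exact_mod_cast h

theorem norm_id_le_one : ‖(1 : H →L[ℂ] H)‖ ≤ 1 := ContinuousLinearMap.norm_id_le

/-- The partial isometry `∑_{i ∈ F} ⟨fᵢ, ·⟩ eᵢ` is a contraction. -/
theorem norm_sum_rankOne_le {e f : ι → H} (he : Orthonormal ℂ e) (hf : Orthonormal ℂ f)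
    (F : Finset ι) : ‖∑ i ∈ F, InnerProductSpace.rankOne ℂ (e i) (f i)‖ ≤ 1 := by
  refine ContinuousLinearMap.opNorm_le_bound _ zero_le_one fun v => ?_
  rw [one_mul]
  refine (sq_le_sq₀ (norm_nonneg _) (norm_nonneg _)).1 (le_trans (le_of_eq ?_)
    (hf.sum_inner_products_le v (s := F)))
  have h : (∑ i ∈ F, InnerProductSpace.rankOne ℂ (e i) (f i)) v =
      ∑ i ∈ F, inner ℂ (f i) v • e i := by
    simp
  have h2 := he.inner_sum (fun i => inner ℂ (f i) v) (fun i => inner ℂ (f i) v) F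
  rw [← h, inner_self_eq_norm_sq_to_K] at h2
  have h3 : ((‖(∑ i ∈ F, InnerProductSpace.rankOne ℂ (e i) (f i)) v‖ ^ 2 : ℝ) : ℂ) =
      ((∑ i ∈ F, ‖inner ℂ (f i) v‖ ^ 2 : ℝ) : ℂ) := by
    rw [Complex.ofReal_pow, Complex.ofReal_sum]
    refine h2.trans (Finset.sum_congr rfl fun i _ => ?_)
    rw [mul_comm, Complex.mul_conj, Complex.normSq_eq_norm_sq]
  exact_mod_cast h3

/-! ### Matrix coefficients in terms of a Schmidt decomposition -/

theorem IsSchmidt.hasSum_inner {x : H →L[ℂ] H} {s : ι → ℝ≥0} {e f : ι → H}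
    (h : IsSchmidt x s e f) (p v : H) :
    HasSum (fun i => (s i : ℂ) * (inner ℂ p (f i) * inner ℂ (e i) v)) (inner ℂ p (x v)) := by
  refine ((h.hasSum v).mapL (innerSL ℂ p)).congr_fun fun i => ?_
  simp only [innerSL_apply_apply, inner_smul_right]
  ring

theorem enorm_coe_nnreal (s : ℝ≥0) : ‖(s : ℂ)‖ₑ = s := by
  rw [enorm_eq_nnnorm]
  congr 1
  ext
  simp

theorem IsSchmidt.enorm_inner_le {x : H →L[ℂ] H} {s : ι → ℝ≥0} {e f : ι → H}
    (h : IsSchmidt x s e f) (p v : H) :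
    ‖inner ℂ p (x v)‖ₑ ≤ ∑' i, s i * (‖inner ℂ p (f i)‖ₑ * ‖inner ℂ (e i) v‖ₑ) := by
  rw [← (h.hasSum_inner p v).tsum_eq]
  refine enorm_tsum_le_tsum_enorm.trans (le_of_eq (tsum_congr fun i => ?_))
  rw [enorm_mul, enorm_mul, enorm_coe_nnreal]

theorem IsSchmidt.apply_left {x : H →L[ℂ] H} {s : ι → ℝ≥0} {e f : ι → H}
    (h : IsSchmidt x s e f) (i : ι) : x (e i) = (s i : ℂ) • f i := by
  classical
  refine (h.hasSum (e i)).unique ?_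
  convert hasSum_single i fun j hj => ?_ using 1
  · simp [inner_self_eq_norm_sq_to_K, h.left.1 i]
  · simp [h.left.2 hj]

theorem IsSchmidt.inner_right_apply {x : H →L[ℂ] H} {s : ι → ℝ≥0} {e f : ι → H}
    (h : IsSchmidt x s e f) (i : ι) (v : H) :
    inner ℂ (f i) (x v) = (s i : ℂ) * inner ℂ (e i) v := by
  classical
  refine (h.hasSum_inner (f i) v).unique ?_
  convert hasSum_single i fun j hj => ?_ using 1
  · simp [inner_self_eq_norm_sq_to_K, h.right.1 i]
  · simp [h.right.2 hj.symm]

theorem IsSchmidt.inner_eq_zero {x : H →L[ℂ] H} {s : ι → ℝ≥0} {e f : ι → H}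
    (h : IsSchmidt x s e f) {p : H} (hp : ∀ i, inner ℂ p (f i) = 0) (v : H) :
    inner ℂ p (x v) = 0 := by
  refine (h.hasSum_inner p v).unique ?_
  simp [hp]

theorem IsSchmidt.inner_apply_self {x : H →L[ℂ] H} {s : ι → ℝ≥0} {e f : ι → H}
    (h : IsSchmidt x s e f) (i : ι) : inner ℂ (f i) (x (e i)) = s i := by
  rw [h.inner_right_apply, inner_self_eq_norm_sq_to_K, h.left.1 i]
  simp

/-- Schmidt series are indexed by the nonzero singular values, modulars by all of `ℕ`; this passes
from one to the other. -/
theorem tsum_singularValue_ne_zero {α : Type*} [AddCommMonoid α] [TopologicalSpace α]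
    (x : H →L[ℂ] H) {g : ℝ≥0 → α} (hg : g 0 = 0) :
    ∑' n : {n // singularValue x n ≠ 0}, g (singularValue x n) = ∑' n, g (singularValue x n) := by
  refine tsum_subtype_eq_of_support_subset (s := {n | singularValue x n ≠ 0})
    (f := fun n => g (singularValue x n)) fun n hn hz => ?_
  exact hn (by simp only [hz, hg])

/-- The singular values are the coefficients `⟨p n, x (q n)⟩`; expanded in the given decomposition
they are dominated by a doubly substochastic matrix applied to `s`, and Jensen's inequality applies.
-/
theorem IsSchmidt.modular_le {x : H →L[ℂ] H} (hx : IsCompactOperator x) {s : ι → ℝ≥0}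
    {e f : ι → H} (h : IsSchmidt x s e f) (θ : ℝ≥0 → ℝ≥0∞) (c : ℝ≥0) :
    modular (complementary θ) c x ≤ ∑' i, complementary θ (c * s i) := by
  obtain ⟨q, p, hx'⟩ := exists_isSchmidt hx
  obtain ⟨w, h1, h2, hw⟩ := exists_weight hx'.right h.right hx'.left h.left
    norm_id_le_one norm_id_le_one
  have := tsum_singularValue_ne_zero x (g := fun t => complementary θ (c * t))
    (by simpa using (isGauge_complementary θ).map_zero)
  rw [modular, ← this]
  refine tsum_complementary_le w h1 h2 _ _ fun n => ?_
  have h3 := h.enorm_inner_le (p n) (q n)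
  rw [hx'.inner_apply_self, enorm_coe_nnreal] at h3
  rw [ENNReal.coe_mul]
  calc (c : ℝ≥0∞) * singularValue x n
      ≤ c * ∑' i, s i * (‖inner ℂ (p n) (f i)‖ₑ * ‖inner ℂ (e i) (q n)‖ₑ) :=
        mul_le_mul_right h3 _
    _ ≤ c * ∑' i, s i * w n i :=
        mul_le_mul_right (ENNReal.tsum_le_tsum fun i => mul_le_mul_right (hw n i) _) _
    _ = ∑' i, w n i * ((c * s i : ℝ≥0) : ℝ≥0∞) := by
        rw [← ENNReal.tsum_mul_left]
        refine tsum_congr fun i => ?_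
        rw [ENNReal.coe_mul]
        ring

/-- The analytic core of Hölder's inequality. The contraction `u` leaves room for the partial
isometry in the polar decomposition of a product. -/
theorem IsSchmidt.tsum_enorm_inner_le {x y : H →L[ℂ] H} {b : κ → ℝ≥0} {e f : κ → H}
    (hx : IsSchmidt x b e f) {s : ι → ℝ≥0} {h g : ι → H} (hy : IsSchmidt y s h g)
    {u : H →L[ℂ] H} (hu : ‖u‖ ≤ 1) (θ : ℝ≥0 → ℝ≥0∞) :
    ∑' k, b k * ‖inner ℂ (e k) (y (u (f k)))‖ₑ ≤
      ∑' k, θ (b k) + ∑' i, complementary θ (s i) := by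
  obtain ⟨w, h1, h2, hw⟩ := exists_weight hx.left hy.right hx.right hy.left norm_id_le_one hu
  refine le_trans (ENNReal.tsum_le_tsum fun k => ?_) (tsum_weight_mul_le w h1 h2 b s)
  refine (mul_le_mul_right (hy.enorm_inner_le _ _) _).trans ?_
  rw [← ENNReal.tsum_mul_left]
  refine ENNReal.tsum_le_tsum fun i => ?_
  rw [← mul_assoc, mul_comm]
  exact mul_le_mul_left (hw k i) _

/-! ### Hölder's inequality -/

/-- With `u = ∑_{n ∈ F} ⟨p n, ·⟩ q n`, a contraction, the partial sum of the `s_n(xy)` is the trace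
of `x y u`, computed along the Schmidt series of `x`. -/
theorem traceNorm_mul_le {x y : H →L[ℂ] H} (hx : IsCompactOperator x) (hy : IsCompactOperator y)
    {θ : ℝ≥0 → ℝ≥0∞} (hθ : IsGauge θ) :
    traceNorm (x * y) ≤ modular θ 1 x + modular (complementary θ) 1 y := by
  have hxy : IsCompactOperator (x * y : H →L[ℂ] H) := hx.comp_clm y
  obtain ⟨q, p, hs⟩ := exists_isSchmidt hxy
  obtain ⟨e, f, hxs⟩ := exists_isSchmidt hx
  obtain ⟨h, g, hys⟩ := exists_isSchmidt hy
  rw [traceNorm, ← tsum_singularValue_ne_zero (x * y) (g := fun t => (t : ℝ≥0∞)) rfl,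
    ENNReal.tsum_eq_iSup_sum]
  refine iSup_le fun F => ?_
  have key := hxs.tsum_enorm_inner_le hys (norm_sum_rankOne_le hs.left hs.right F) θ
  rw [tsum_singularValue_ne_zero x hθ.map_zero,
    tsum_singularValue_ne_zero y (isGauge_complementary θ).map_zero] at key
  simp only [modular, one_mul]
  refine le_trans ?_ key
  have h1 : HasSum (fun k : {n // singularValue x n ≠ 0} => ((singularValue x k : ℝ≥0) : ℂ) *
      inner ℂ (e k) (y ((∑ i ∈ F, InnerProductSpace.rankOne ℂ (q i) (p i)) (f k))))
      (∑ n ∈ F, ((singularValue (x * y) n : ℝ≥0) : ℂ)) := by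
    have h2 := hasSum_sum (s := F) fun n _ => hxs.hasSum_inner (p n) (y (q n))
    have h3 : ∑ n ∈ F, ((singularValue (x * y) n : ℝ≥0) : ℂ) =
        ∑ n ∈ F, inner ℂ (p n) (x (y (q n))) :=
      Finset.sum_congr rfl fun n _ => (hs.inner_apply_self n).symm
    rw [h3]
    refine h2.congr_fun fun k => ?_
    simp only [sum_apply, InnerProductSpace.rankOne_apply, map_sum, map_smul,
      inner_sum, inner_smul_right, Finset.mul_sum]
  have h4 : ∑ n ∈ F, ((singularValue (x * y) n : ℝ≥0) : ℝ≥0∞) =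
      ‖∑ n ∈ F, ((singularValue (x * y) n : ℝ≥0) : ℂ)‖ₑ := by
    rw [← ENNReal.ofNNReal_finsetSum, ← enorm_coe_nnreal]
    push_cast
    rfl
  rw [h4, ← h1.tsum_eq]
  refine enorm_tsum_le_tsum_enorm.trans (le_of_eq (tsum_congr fun k => ?_))
  rw [enorm_mul, enorm_coe_nnreal]

/-! ### The trace -/

theorem tsum_enorm_inner_le_traceNorm {a : H →L[ℂ] H} (ha : IsCompactOperator a) {e f : κ → H}
    (he : Orthonormal ℂ e) (hf : Orthonormal ℂ f) :
    ∑' k, ‖inner ℂ (e k) (a (f k))‖ₑ ≤ traceNorm a := by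
  obtain ⟨q, p, hs⟩ := exists_isSchmidt ha
  obtain ⟨w, -, h2, hw⟩ := exists_weight he hs.right hf hs.left norm_id_le_one norm_id_le_one
  rw [traceNorm, ← tsum_singularValue_ne_zero a (g := fun t => (t : ℝ≥0∞)) rfl]
  refine (ENNReal.tsum_le_tsum fun k => hs.enorm_inner_le _ _).trans ?_
  rw [ENNReal.tsum_comm]
  refine ENNReal.tsum_le_tsum fun n => ?_
  rw [ENNReal.tsum_mul_left]
  calc _ ≤ (singularValue a n : ℝ≥0∞) * 1 :=
        mul_le_mul_right ((ENNReal.tsum_le_tsum fun k => hw k n).trans (h2 n)) _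
    _ = _ := mul_one _

theorem HasTrace.unique {a : H →L[ℂ] H} {s t : ℂ} (hs : HasTrace a s) (ht : HasTrace a t) :
    s = t := by
  obtain ⟨w, b, -⟩ := exists_hilbertBasis ℂ H
  exact (hs.2 w b).unique (ht.2 w b)

theorem HasTrace.add {a b : H →L[ℂ] H} {s t : ℂ} (hs : HasTrace a s) (ht : HasTrace b t)
    (hab : IsTraceClass (a + b)) : HasTrace (a + b) (s + t) := by
  refine ⟨hab, fun ι e => ?_⟩
  simpa [inner_add_right] using (hs.2 ι e).add (ht.2 ι e)

theorem HasTrace.smul {a : H →L[ℂ] H} {s : ℂ} (hs : HasTrace a s) (c : ℂ)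
    (hca : IsTraceClass (c • a)) : HasTrace (c • a) (c * s) := by
  refine ⟨hca, fun ι e => ?_⟩
  simpa [inner_smul_right] using (hs.2 ι e).mul_left c

/-- Independence of the basis by Fubini for the absolutely summable array `G`: summing over the
basis first gives `s_n ⟨q n, p n⟩` by Parseval, summing over `n` first gives the diagonal entries.
-/
theorem IsTraceClass.exists_hasTrace {a : H →L[ℂ] H} (ha : IsTraceClass a) :
    ∃ t, HasTrace a t := by
  obtain ⟨q, p, hs⟩ := exists_isSchmidt ha.1
  refine ⟨∑' n : {n // singularValue a n ≠ 0},
    ((singularValue a n : ℝ≥0) : ℂ) * inner ℂ (q n) (p n), ha, fun ι g => ?_⟩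
  let G : {n // singularValue a n ≠ 0} × ι → ℂ := fun z =>
    ((singularValue a z.1 : ℝ≥0) : ℂ) * (inner ℂ (g z.2) (p z.1) * inner ℂ (q z.1) (g z.2))
  obtain ⟨w, -, h2, hw⟩ := exists_weight g.orthonormal hs.right g.orthonormal hs.left
    norm_id_le_one norm_id_le_one
  have hG : Summable G := by
    refine Summable.of_enorm (ne_top_of_le_ne_top ha.2.ne ?_)
    rw [ENNReal.tsum_prod', traceNorm,
      ← tsum_singularValue_ne_zero a (g := fun t => (t : ℝ≥0∞)) rfl]
    refine ENNReal.tsum_le_tsum fun n => ?_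
    simp only [G, enorm_mul, enorm_coe_nnreal]
    rw [ENNReal.tsum_mul_left]
    calc _ ≤ (singularValue a n : ℝ≥0∞) * 1 :=
          mul_le_mul_right ((ENNReal.tsum_le_tsum fun k => hw k n).trans (h2 n)) _
      _ = _ := mul_one _
  have h3 := hG.hasSum.prod_fiberwise fun n =>
    ((g.hasSum_inner_mul_inner (q n) (p n)).mul_left ((singularValue a n : ℝ≥0) : ℂ)).congr_fun
      fun k => by simp only [G]; ring
  rw [h3.tsum_eq]
  have h4 := ((Equiv.prodComm _ _).hasSum_iff (f := G)).2 hG.hasSum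
  exact h4.prod_fiberwise fun k => hs.hasSum_inner (g k) (g k)

/-- The trace is computed in a Hilbert basis extending `f`; the other diagonal entries vanish
because `x` takes values in the closed span of `f`. -/
theorem IsSchmidt.hasSum_of_hasTrace {x y : H →L[ℂ] H} {s : ι → ℝ≥0} {e f : ι → H}
    (h : IsSchmidt x s e f) {t : ℂ} (ht : HasTrace (x * y) t) :
    HasSum (fun i => (s i : ℂ) * inner ℂ (e i) (y (f i))) t := by
  obtain ⟨w, b, hw, hb⟩ := Orthonormal.exists_hilbertBasis_extension
    (𝕜 := ℂ) (s := range f) h.right.toSubtypeRange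
  let g : ι → w := fun n => ⟨f n, hw (mem_range_self n)⟩
  have hg : Function.Injective g := fun m n hmn =>
    h.right.linearIndependent.injective (congrArg Subtype.val hmn)
  have hgb : ∀ n, b (g n) = f n := fun n => by rw [hb]
  have h1 := ht.2 w b
  rw [← hg.hasSum_iff] at h1
  · refine h1.congr_fun fun i => ?_
    simp only [Function.comp_apply, hgb]
    exact (h.inner_right_apply i (y (f i))).symm
  · intro k hk
    refine h.inner_eq_zero (fun i => ?_) _
    rw [← hgb]
    exact b.orthonormal.2 fun hki => hk ⟨i, hki.symm⟩

theorem HasTrace.enorm_le {a : H →L[ℂ] H} {t : ℂ} (ht : HasTrace a t) : ‖t‖ₑ ≤ traceNorm a := by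
  obtain ⟨w, b, -⟩ := exists_hilbertBasis ℂ H
  rw [← (ht.2 w b).tsum_eq]
  exact enorm_tsum_le_tsum_enorm.trans
    (tsum_enorm_inner_le_traceNorm ht.1.1 b.orthonormal b.orthonormal)

/-- The series for `Tr (xy)` along the Schmidt vectors is the diagonal of `y x` along `e`. The swap
is needed because the functional has `x` on the left, the Orlicz norm of `y` has it on the right. -/
theorem HasTrace.enorm_le_traceNorm_swap {x y : H →L[ℂ] H} (hx : IsCompactOperator x) {t : ℂ}
    (ht : HasTrace (x * y) t) : ‖t‖ₑ ≤ traceNorm (y * x) := by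
  obtain ⟨e, f, h⟩ := exists_isSchmidt hx
  rw [← (h.hasSum_of_hasTrace ht).tsum_eq]
  refine le_trans ?_ (tsum_enorm_inner_le_traceNorm (hx.clm_comp y) h.left h.left)
  refine enorm_tsum_le_tsum_enorm.trans (le_of_eq (tsum_congr fun i => ?_))
  have h1 : (y * x) (e i) = ((singularValue x i : ℝ≥0) : ℂ) • y (f i) := by
    rw [mul_apply_eq_comp, h.apply_left, map_smul]
  rw [h1, inner_smul_right]

/-! ### Operators of finite rank -/

theorem isCompactOperator_comp_of_finiteDimensional {V : Type*} [NormedAddCommGroup V]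
    [NormedSpace ℂ V] [FiniteDimensional ℂ V] (a : V →L[ℂ] H) (b : H →L[ℂ] V) :
    IsCompactOperator (a ∘L b) := by
  have : ProperSpace V := FiniteDimensional.proper ℂ V
  have h : IsCompactOperator (ContinuousLinearMap.id ℂ V) :=
    ⟨Metric.closedBall 0 1, isCompact_closedBall _ _,
      Metric.closedBall_mem_nhds _ one_pos⟩
  exact (h.comp_clm b).clm_comp a

theorem isCompactOperator_rankOne (a b : H) :
    IsCompactOperator (InnerProductSpace.rankOne ℂ a b : H →L[ℂ] H) := by
  rw [InnerProductSpace.rankOne_def']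
  exact isCompactOperator_comp_of_finiteDimensional _ _

theorem isSchmidt_sum_rankOne [Fintype ι] {e f : ι → H} (he : Orthonormal ℂ e)
    (hf : Orthonormal ℂ f) (s : ι → ℝ≥0) :
    IsSchmidt (∑ i, (s i : ℂ) • InnerProductSpace.rankOne ℂ (f i) (e i)) s e f := by
  refine ⟨he, hf, fun v => ?_⟩
  have h : (∑ i, (s i : ℂ) • InnerProductSpace.rankOne ℂ (f i) (e i)) v =
      ∑ i, ((s i : ℂ) * inner ℂ (e i) v) • f i := by
    simp only [sum_apply, smul_apply, InnerProductSpace.rankOne_apply, smul_smul]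
  rw [h]
  exact hasSum_fintype _

/-- If `V` is a test space for `x`, then `u* V` is one for `x u`: `v ⊥ u* V` means `u v ⊥ V`. -/
theorem singularValue_comp_le {x u : H →L[ℂ] H} (hx : IsCompactOperator x) (hu : ‖u‖ ≤ 1)
    (n : ℕ) : singularValue (x * u) n ≤ singularValue x n := by
  refine le_of_forall_gt_imp_ge_of_dense fun t ht => ?_
  obtain ⟨V, hV, hVx⟩ := exists_submodule hx ht
  refine singularValue_le (V.map (ContinuousLinearMap.adjoint u : H →ₗ[ℂ] H))
    ((rank_map_le _ _).trans hV) fun v hv => ?_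
  have h1 : u v ∈ Vᗮ := by
    intro w hw
    have := hv _ (Submodule.mem_map_of_mem hw)
    rwa [ContinuousLinearMap.coe_coe, ContinuousLinearMap.adjoint_inner_left] at this
  refine (hVx _ h1).trans (mul_le_mul_of_nonneg_left ?_ t.2)
  simpa using u.le_of_opNorm_le hu v

theorem modular_comp_le {θ : ℝ≥0 → ℝ≥0∞} (hθ : IsGauge θ) {x u : H →L[ℂ] H}
    (hx : IsCompactOperator x) (hu : ‖u‖ ≤ 1) (c : ℝ≥0) : modular θ c (x * u) ≤ modular θ c x :=
  ENNReal.tsum_le_tsum fun n => hθ.monotone (mul_le_mul_right (singularValue_comp_le hx hu n) c)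

end Pairing

section Duality

variable {H : Type u} [NormedAddCommGroup H] [InnerProductSpace ℂ H] [CompleteSpace H]
  {ι : Type*}

/-! ### Modulars -/

theorem modular_one_smul_le {θ : ℝ≥0 → ℝ≥0∞} (hθ : IsGauge θ) {x : H →L[ℂ] H}
    (hx : IsCompactOperator x) (c : ℝ≥0) : modular θ 1 ((c : ℂ) • x) ≤ modular θ c x := by
  have h := modular_smul_le hθ hx (c : ℂ) 1
  have hc : ‖(c : ℂ)‖₊ = c := by ext; simp
  rwa [hc, one_mul] at h

theorem modular_mul_complementary_le (θ : ℝ≥0 → ℝ≥0∞) {t : ℝ≥0} (ht : t ≤ 1) (c : ℝ≥0)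
    (x : H →L[ℂ] H) :
    modular (complementary θ) (t * c) x ≤ t * modular (complementary θ) c x := by
  rw [modular, modular, ← ENNReal.tsum_mul_left]
  refine ENNReal.tsum_le_tsum fun n => ?_
  rw [mul_assoc]
  exact complementary_mul_le θ ht _

/-- Convexity allows scaling down by any factor at least `1`; `1 + M` is such a factor even when `M
< 1`. -/
theorem modular_inv_le_one (θ : ℝ≥0 → ℝ≥0∞) {c M : ℝ≥0} {x : H →L[ℂ] H}
    (h : modular (complementary θ) c x ≤ M) :
    modular (complementary θ) ((1 + M)⁻¹ * c) x ≤ 1 := by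
  have hM : (0 : ℝ≥0) < 1 + M := by positivity
  refine (modular_mul_complementary_le θ (inv_le_one_of_one_le₀ le_self_add) c x).trans ?_
  refine (mul_le_mul_right h _).trans ?_
  rw [← ENNReal.coe_mul]
  have : (1 + M)⁻¹ * M ≤ 1 := by
    rw [inv_mul_le_iff₀ hM, mul_one]
    exact le_add_self
  exact_mod_cast this

theorem traceNorm_smul_le {x : H →L[ℂ] H} (hx : IsCompactOperator x) (c : ℂ) :
    traceNorm (c • x) ≤ ‖c‖ₑ * traceNorm x := by
  rw [traceNorm, traceNorm, ← ENNReal.tsum_mul_left]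
  refine ENNReal.tsum_le_tsum fun n => ?_
  rw [enorm_eq_nnnorm]
  exact_mod_cast singularValue_smul_le hx c n

theorem traceNorm_mul_le_modular {x y : H →L[ℂ] H} (hx : IsCompactOperator x)
    (hy : IsCompactOperator y) {θ : ℝ≥0 → ℝ≥0∞} (hθ : IsGauge θ) {c d : ℝ≥0} (hc : 0 < c)
    (hd : 0 < d) : traceNorm (x * y) ≤
      ((d * c⁻¹ : ℝ≥0) : ℝ≥0∞) * (modular θ d⁻¹ x + modular (complementary θ) c y) := by
  have h : x * y = ((d * c⁻¹ : ℝ≥0) : ℂ) • ((((d⁻¹ : ℝ≥0) : ℂ) • x) * ((c : ℂ) • y)) := by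
    have hc' : (c : ℂ) ≠ 0 := by simpa using hc.ne'
    have hd' : (d : ℂ) ≠ 0 := by simpa using hd.ne'
    have : ((d * c⁻¹ : ℝ≥0) : ℂ) * (((d⁻¹ : ℝ≥0) : ℂ) * (c : ℂ)) = 1 := by
      push_cast
      field_simp
    rw [smul_mul_smul_comm, smul_smul, this, one_smul]
  rw [h]
  have hx' : IsCompactOperator (((d⁻¹ : ℝ≥0) : ℂ) • x : H →L[ℂ] H) := hx.smul _
  refine (traceNorm_smul_le (hx'.comp_clm _) _).trans ?_
  rw [enorm_coe_nnreal]
  refine mul_le_mul_right ((traceNorm_mul_le hx' (hy.smul _) hθ).trans ?_) _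
  exact add_le_add (modular_one_smul_le hθ hx _)
    (modular_one_smul_le (isGauge_complementary θ) hy _)

theorem isTraceClass_mul {θ : ℝ≥0 → ℝ≥0∞} (hθ : IsGauge θ) {x y : H →L[ℂ] H}
    (hx : x ∈ orliczHeart H hθ) (hy : y ∈ orliczSpace H (isGauge_complementary θ)) :
    IsTraceClass (x * y) := by
  obtain ⟨hyc, c, hc, hcy⟩ := hy
  refine ⟨hx.1.comp_clm y, (traceNorm_mul_le_modular hx.1 hyc hθ hc one_pos).trans_lt ?_⟩
  exact ENNReal.mul_lt_top ENNReal.coe_lt_top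
    (ENNReal.add_lt_top.2 ⟨hx.2 _ (inv_pos.2 one_pos), hcy⟩)

/-! ### Operators of rank one -/

theorem modular_rankOne_le {θ : ℝ≥0 → ℝ≥0∞} (hθ : IsGauge θ) (c : ℝ≥0) (a b : H) :
    modular θ c (InnerProductSpace.rankOne ℂ a b) ≤ θ (c * (‖a‖₊ * ‖b‖₊)) := by
  have h : ∀ n ≠ 0, θ (c * singularValue (InnerProductSpace.rankOne ℂ a b) n) = 0 := by
    intro n hn
    have : singularValue (InnerProductSpace.rankOne ℂ a b) n = 0 := by
      refine le_antisymm (singularValue_le (Submodule.span ℂ {b}) ?_ fun v hv => ?_) zero_le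
      · refine (rank_span_le _).trans ?_
        rw [Cardinal.mk_singleton]
        exact_mod_cast Nat.one_le_iff_ne_zero.2 hn
      · rw [Submodule.mem_orthogonal_singleton_iff_inner_right] at hv
        simp [hv]
    rw [this, mul_zero, hθ.map_zero]
  rw [modular, tsum_eq_single 0 h]
  refine hθ.monotone (mul_le_mul_right (singularValue_le ⊥ (by simp) fun v _ => ?_) c)
  have := (InnerProductSpace.rankOne ℂ a b : H →L[ℂ] H).le_opNorm v
  rw [InnerProductSpace.norm_rankOne] at this
  simpa using this

theorem rankOne_mem_orliczHeart {θ : ℝ≥0 → ℝ≥0∞} (hθ : IsGauge θ) (hfin : ∀ u, θ u ≠ ∞)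
    (a b : H) : (InnerProductSpace.rankOne ℂ a b : H →L[ℂ] H) ∈ orliczHeart H hθ :=
  ⟨isCompactOperator_rankOne a b, fun c _ =>
    (modular_rankOne_le hθ c a b).trans_lt (hfin _).lt_top⟩

/-- The rank one operator `⟨b, ·⟩ a` as an element of `E_θ`. -/
noncomputable def rankOneHeart {θ : ℝ≥0 → ℝ≥0∞} (hθ : IsGauge θ) (hfin : ∀ u, θ u ≠ ∞) (a b : H) :
    orliczHeart H hθ :=
  ⟨InnerProductSpace.rankOne ℂ a b, rankOne_mem_orliczHeart hθ hfin a b⟩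

theorem HasTrace.rankOne_mul_eq {a b : H} {y : H →L[ℂ] H} {t : ℂ}
    (h : HasTrace ((InnerProductSpace.rankOne ℂ a b : H →L[ℂ] H) * y) t) :
    t = inner ℂ b (y a) := by
  obtain ⟨w, g, -⟩ := exists_hilbertBasis ℂ H
  refine (h.2 w g).unique ?_
  rw [← ContinuousLinearMap.adjoint_inner_left]
  refine (g.hasSum_inner_mul_inner (ContinuousLinearMap.adjoint y b) a).congr_fun fun k => ?_
  rw [mul_apply_eq_comp, InnerProductSpace.rankOne_apply, inner_smul_right,
    ContinuousLinearMap.adjoint_inner_left]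

/-! ### Norms dominated by the modular -/

/-- A positively homogeneous gauge of operators with `N x ≤ 1 + Tr θ(x)`. -/
structure IsModularNorm (θ : ℝ≥0 → ℝ≥0∞) (N : (H →L[ℂ] H) → ℝ≥0∞) : Prop where
  smul_le : ∀ x : H →L[ℂ] H, IsCompactOperator x → ∀ a : ℂ, N (a • x) ≤ ‖a‖ₑ * N x
  le_modular : ∀ x : H →L[ℂ] H, IsCompactOperator x → N x ≤ 1 + modular θ 1 x

theorem IsModularNorm.rankOne_le {θ : ℝ≥0 → ℝ≥0∞} {N : (H →L[ℂ] H) → ℝ≥0∞}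
    (hN : IsModularNorm θ N) (hθ : IsGauge θ) (a b : H) :
    N (InnerProductSpace.rankOne ℂ a b) ≤ ‖a‖ₑ * ‖b‖ₑ * (1 + θ 1) := by
  have unit : ∀ v : H, ‖((‖v‖ : ℂ)⁻¹) • v‖₊ ≤ 1 := by
    intro v
    rw [← NNReal.coe_le_coe, coe_nnnorm, norm_smul]
    simpa using inv_mul_le_one (a := ‖v‖)
  have self : ∀ v : H, (‖v‖ : ℂ) • ((‖v‖ : ℂ)⁻¹) • v = v := by
    intro v
    rcases eq_or_ne v 0 with rfl | hv
    · simp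
    · rw [smul_inv_smul₀]
      simpa using hv
  have h : (InnerProductSpace.rankOne ℂ a b : H →L[ℂ] H) = ((‖a‖ : ℂ) * (‖b‖ : ℂ)) •
      InnerProductSpace.rankOne ℂ (((‖a‖ : ℂ)⁻¹) • a) (((‖b‖ : ℂ)⁻¹) • b) := by
    conv_lhs => rw [← self a, ← self b]
    ext v
    simp only [smul_apply, InnerProductSpace.rankOne_apply, inner_smul_left, smul_smul]
    congr 1
    simp only [map_mul, map_inv₀, Complex.conj_ofReal]
    ring
  rw [h]
  refine (hN.smul_le _ (isCompactOperator_rankOne _ _) _).trans (mul_le_mul' ?_ ?_)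
  · have hn : ∀ v : H, ‖(‖v‖ : ℂ)‖ₑ = ‖v‖ₑ := fun v => by
      rw [enorm_eq_nnnorm, enorm_eq_nnnorm]
      congr 1
      ext
      simp
    rw [enorm_mul, hn, hn]
  · refine (hN.le_modular _ (isCompactOperator_rankOne _ _)).trans ?_
    gcongr
    refine (modular_rankOne_le hθ _ _ _).trans (hθ.monotone ?_)
    rw [one_mul]
    exact mul_le_one₀ (unit a) zero_le (unit b)

/-- The form `(b, a) ↦ L(⟨b, ·⟩ a)` is sesquilinear and bounded by a multiple of `1 + θ 1`, so the
Riesz theorem applies. Finiteness of `θ` gives both that constant and the membership of rank one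
operators in `E_θ`. -/
theorem exists_rankOne_representation {θ : ℝ≥0 → ℝ≥0∞} (hθ : IsGauge θ) (hfin : ∀ u, θ u ≠ ∞)
    {N : (H →L[ℂ] H) → ℝ≥0∞} (hN : IsModularNorm θ N)
    {L : orliczHeart H hθ →ₗ[ℂ] ℂ} (hL : L ∈ boundedDual (orliczHeart H hθ) N) :
    ∃ y : H →L[ℂ] H, ∀ a b, L (rankOneHeart hθ hfin a b) = inner ℂ b (y a) := by
  obtain ⟨C, hC⟩ := hL
  have hbound : ∀ a b : H, ‖L (rankOneHeart hθ hfin a b)‖ ≤ C * (1 + (θ 1).toReal) * ‖b‖ * ‖a‖ := by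
    intro a b
    have h : ‖L (rankOneHeart hθ hfin a b)‖ₑ ≤ C * (‖a‖ₑ * ‖b‖ₑ * (1 + θ 1)) :=
      (hC _).trans (mul_le_mul_right (hN.rankOne_le hθ a b) _)
    have hf := hfin 1
    lift θ 1 to ℝ≥0 using hf with K hK
    simp only [enorm_eq_nnnorm] at h
    have h' : ‖L (rankOneHeart hθ hfin a b)‖₊ ≤ C * (‖a‖₊ * ‖b‖₊ * (1 + K)) := by exact_mod_cast h
    have h'' : ‖L (rankOneHeart hθ hfin a b)‖ ≤ C * (‖a‖ * ‖b‖ * (1 + K)) := by exact_mod_cast h'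
    rw [ENNReal.coe_toReal]
    linarith
  let B : H →ₗ⋆[ℂ] H →ₗ[ℂ] ℂ := LinearMap.mk₂'ₛₗ (starRingEnd ℂ) (RingHom.id ℂ)
    (fun b a => L (rankOneHeart hθ hfin a b))
    (fun b₁ b₂ a => by
      rw [← map_add]; congr 1; ext1; simp [rankOneHeart])
    (fun c b a => by
      rw [smul_eq_mul, ← smul_eq_mul, ← map_smul]; congr 1; ext1; simp [rankOneHeart])
    (fun b a₁ a₂ => by
      rw [← map_add]; congr 1; ext1; simp [rankOneHeart])
    (fun c b a => by
      rw [← map_smul]; congr 1; ext1; simp [rankOneHeart])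
  let B' : H →L⋆[ℂ] H →L[ℂ] ℂ := LinearMap.mkContinuous₂ B (C * (1 + (θ 1).toReal))
    fun b a => hbound a b
  refine ⟨ContinuousLinearMap.adjoint (InnerProductSpace.continuousLinearMapOfBilin B'),
    fun a b => ?_⟩
  rw [ContinuousLinearMap.adjoint_inner_right, InnerProductSpace.continuousLinearMapOfBilin_apply]
  rfl

/-- Testing a functional on operators of finite rank bounds the modular of its symbol. -/
theorem sum_complementary_le_one {θ : ℝ≥0 → ℝ≥0∞} (hθ : IsGauge θ) (hfin : ∀ u, θ u ≠ ∞)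
    (hθθ : complementary (complementary θ) = θ) {N : (H →L[ℂ] H) → ℝ≥0∞} (hN : IsModularNorm θ N)
    {L : orliczHeart H hθ →ₗ[ℂ] ℂ} {D : ℝ≥0} (hD : 0 < D) (hL : ∀ x, ‖L x‖ₑ ≤ D * N x)
    {y : H →L[ℂ] H} (hy : ∀ a b, L (rankOneHeart hθ hfin a b) = inner ℂ b (y a))
    [Fintype ι] {e f : ι → H} (he : Orthonormal ℂ e) (hf : Orthonormal ℂ f) (c : ι → ℝ≥0)
    (hc : ∀ i, inner ℂ (f i) (y (e i)) = c i) :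
    ∑ i, complementary θ (D⁻¹ * c i) ≤ 1 := by
  refine sum_complementary_le hθ _ _ fun b => ?_
  let x : orliczHeart H hθ := ∑ i, (b i : ℂ) • rankOneHeart hθ hfin (e i) (f i)
  have hx : (x : H →L[ℂ] H) = ∑ i, (b i : ℂ) • InnerProductSpace.rankOne ℂ (e i) (f i) := by
    simp [x, rankOneHeart]
  have hLx : ‖L x‖ₑ = ∑ i, (c i * b i : ℝ≥0∞) := by
    have : L x = ((∑ i, c i * b i : ℝ≥0) : ℂ) := by
      simp only [x, map_sum, map_smul, hy, hc, smul_eq_mul]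
      push_cast
      exact Finset.sum_congr rfl fun i _ => mul_comm _ _
    rw [this, enorm_coe_nnreal]
    push_cast
    rfl
  have hmod : modular θ 1 (x : H →L[ℂ] H) ≤ ∑ i, θ (b i) := by
    -- The bound on modulars is available for complementary functions only; `θ` is one by
    -- biconjugation.
    have h := (isSchmidt_sum_rankOne hf he b).modular_le (hx ▸ x.2.1) (complementary θ) 1
    rw [hθθ, tsum_fintype, ← hx] at h
    simpa using h
  have h1 := (hL x).trans (mul_le_mul_right
    ((hN.le_modular x x.2.1).trans (add_le_add_right hmod 1)) _)
  rw [hLx] at h1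
  have hD' : ((D⁻¹ : ℝ≥0) : ℝ≥0∞) * D = 1 := by
    rw [← ENNReal.coe_mul, inv_mul_cancel₀ hD.ne', ENNReal.coe_one]
  calc ∑ i, (((D⁻¹ * c i : ℝ≥0) : ℝ≥0∞) * b i) = ((D⁻¹ : ℝ≥0) : ℝ≥0∞) * ∑ i, (c i * b i : ℝ≥0∞) := by
        rw [Finset.mul_sum]
        refine Finset.sum_congr rfl fun i _ => ?_
        rw [ENNReal.coe_mul, mul_assoc]
    _ ≤ ((D⁻¹ : ℝ≥0) : ℝ≥0∞) * (D * (1 + ∑ i, θ (b i))) := mul_le_mul_right h1 _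
    _ = _ := by rw [← mul_assoc, hD', one_mul]

/-! ### Compactness of the symbol -/

/-- Composing `y` with the projection onto `V` gives finite rank operators converging to `y` in
norm. -/
theorem isCompactOperator_of_forall_exists {y : H →L[ℂ] H}
    (h : ∀ ε : ℝ, 0 < ε → ∃ V : Submodule ℂ H, FiniteDimensional ℂ V ∧
      ∀ v ∈ Vᗮ, ‖y v‖ ≤ ε * ‖v‖) : IsCompactOperator y := by
  have hcl : y ∈ closure {z : H →L[ℂ] H | IsCompactOperator z} := by
    refine Metric.mem_closure_iff.2 fun ε hε => ?_
    obtain ⟨V, hV, hVy⟩ := h (ε / 2) (half_pos hε)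
    refine ⟨(y ∘L V.subtypeL) ∘L V.orthogonalProjectionOnto,
      isCompactOperator_comp_of_finiteDimensional _ _, ?_⟩
    rw [dist_eq_norm]
    refine lt_of_le_of_lt (ContinuousLinearMap.opNorm_le_bound _ (half_pos hε).le fun v => ?_)
      (half_lt_self hε)
    have h1 : (y - (y ∘L V.subtypeL) ∘L V.orthogonalProjectionOnto) v =
        y (v - V.starProjection v) := by
      rw [map_sub]
      rfl
    rw [h1]
    refine (hVy _ (Submodule.sub_starProjection_mem_orthogonal v)).trans
      (mul_le_mul_of_nonneg_left ?_ (half_pos hε).le)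
    rw [← Submodule.starProjection_orthogonal_val]
    exact Submodule.norm_starProjection_apply_le _ _
  rwa [isClosed_setOfPred_isCompactOperator.closure_eq] at hcl

theorem exists_orthonormal_of_not_isCompactOperator {y : H →L[ℂ] H}
    (h : ¬ IsCompactOperator y) : ∃ ε : ℝ≥0, 0 < ε ∧ ∀ n : ℕ, ∃ e : Fin n → H, Orthonormal ℂ e ∧
      (Pairwise fun i j => inner ℂ (y (e i)) (y (e j)) = 0) ∧ ∀ i, ε < ‖y (e i)‖₊ := by
  have h1 := mt isCompactOperator_of_forall_exists h
  push Not at h1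
  obtain ⟨ε, hε, hV⟩ := h1
  refine ⟨⟨ε, hε.le⟩, hε, fun n => ?_⟩
  induction n with
  | zero => exact ⟨Fin.elim0, ⟨fun i => i.elim0, fun i => i.elim0⟩, fun i => i.elim0, fun i => i.elim0⟩
  | succ n ih =>
    obtain ⟨e, he, hye, hεe⟩ := ih
    -- Orthogonality to the vectors `y* y (e i)` as well makes the new image orthogonal to the
    -- previous ones.
    obtain ⟨v, hv, hvy⟩ := hV (Submodule.span ℂ (range e ∪ range fun i =>
      ContinuousLinearMap.adjoint y (y (e i))))
      (FiniteDimensional.span_of_finite ℂ ((finite_range _).union (finite_range _)))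
    have hv0 : ‖v‖ ≠ 0 := by
      intro h0
      have : v = 0 := norm_eq_zero.1 h0
      simp [this] at hvy
    set v' : H := ((‖v‖ : ℂ)⁻¹) • v with hv'
    have hv'1 : ‖v'‖ = 1 := by
      rw [hv', norm_smul]
      simp [hv0]
    have hv'mem := Submodule.smul_mem _ ((‖v‖ : ℂ)⁻¹) hv
    have ho : ∀ i, inner ℂ (e i) v' = 0 := fun i =>
      hv'mem _ (Submodule.subset_span (Or.inl (mem_range_self i)))
    have hoy : ∀ i, inner ℂ (y (e i)) (y v') = 0 := fun i => by
      rw [← ContinuousLinearMap.adjoint_inner_left]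
      exact hv'mem _ (Submodule.subset_span (Or.inr (mem_range_self i)))
    have hyv : ε < ‖y v'‖ := by
      rw [hv', map_smul, norm_smul]
      have : 0 < ‖v‖ := lt_of_le_of_ne (norm_nonneg _) hv0.symm
      simp only [norm_inv, Complex.norm_real, norm_norm]
      rwa [lt_inv_mul_iff₀ this, mul_comm]
    refine ⟨Fin.cons v' e, ⟨fun i => ?_, fun i j hij => ?_⟩, fun i j hij => ?_, fun i => ?_⟩
    · refine Fin.cases hv'1 (fun i => ?_) i
      exact he.1 i
    · induction i using Fin.cases with
      | zero =>
        induction j using Fin.cases with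
        | zero => exact absurd rfl hij
        | succ j => exact inner_eq_zero_symm.1 (ho j)
      | succ i =>
        induction j using Fin.cases with
        | zero => exact ho i
        | succ j => exact he.2 fun h => hij (congrArg _ h)
    · induction i using Fin.cases with
      | zero =>
        induction j using Fin.cases with
        | zero => exact absurd rfl hij
        | succ j => exact inner_eq_zero_symm.1 (hoy j)
      | succ i =>
        induction j using Fin.cases with
        | zero => exact hoy i
        | succ j => exact hye fun h => hij (congrArg _ h)
    · refine Fin.cases ?_ (fun i => ?_) i
      · exact hyv
      · exact hεe i

/-- If `y` were not compact, testing on `n` orthonormal vectors with orthogonal images of norm above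
`ε` would give `n * θ'(ε / D) ≤ 1` for all `n`, with `θ'` complementary to `θ`, against positivity.
-/
theorem isCompactOperator_of_bounded {θ : ℝ≥0 → ℝ≥0∞} (hθ : IsGauge θ) (hfin : ∀ u, θ u ≠ ∞)
    (hθθ : complementary (complementary θ) = θ) (hpos : ∀ v, 0 < v → 0 < complementary θ v)
    {N : (H →L[ℂ] H) → ℝ≥0∞} (hN : IsModularNorm θ N)
    {L : orliczHeart H hθ →ₗ[ℂ] ℂ} {D : ℝ≥0} (hD : 0 < D) (hL : ∀ x, ‖L x‖ₑ ≤ D * N x)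
    {y : H →L[ℂ] H} (hy : ∀ a b, L (rankOneHeart hθ hfin a b) = inner ℂ b (y a)) :
    IsCompactOperator y := by
  by_contra hcon
  obtain ⟨ε, hε, hn⟩ := exists_orthonormal_of_not_isCompactOperator hcon
  have hle : ∀ n : ℕ, n * complementary θ (D⁻¹ * ε) ≤ 1 := by
    intro n
    obtain ⟨e, he, hye, hεe⟩ := hn n
    have h0 : ∀ i, ‖y (e i)‖ ≠ 0 := fun i h => by
      have := hεe i
      rw [← NNReal.coe_lt_coe, coe_nnnorm, h] at this
      exact absurd this (not_lt.2 ε.2)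
    have hf : Orthonormal ℂ fun i => ((‖y (e i)‖ : ℂ)⁻¹) • y (e i) := by
      refine ⟨fun i => ?_, fun i j hij => ?_⟩
      · rw [norm_smul]
        simp [h0 i]
      · beta_reduce
        rw [inner_smul_left, inner_smul_right, hye hij]
        simp
    have h1 := sum_complementary_le_one hθ hfin hθθ hN hD hL hy he hf (fun i => ‖y (e i)‖₊)
      fun i => by
        have : (‖y (e i)‖ : ℂ) ≠ 0 := by simpa using h0 i
        rw [inner_smul_left, inner_self_eq_norm_sq_to_K]
        simp only [map_inv₀, Complex.conj_ofReal, coe_nnnorm]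
        change (‖y (e i)‖ : ℂ)⁻¹ * (‖y (e i)‖ : ℂ) ^ 2 = _
        field_simp
    refine le_trans ?_ h1
    have h2 := Finset.sum_le_sum (s := Finset.univ) (f := fun _ : Fin n => complementary θ (D⁻¹ * ε))
      (g := fun i => complementary θ (D⁻¹ * ‖y (e i)‖₊)) fun i _ =>
        (isGauge_complementary θ).monotone (mul_le_mul_right (hεe i).le _)
    simpa using h2
  have hp : complementary θ (D⁻¹ * ε) ≠ 0 := (hpos _ (by positivity)).ne'
  have htop : (∞ : ℝ≥0∞) * complementary θ (D⁻¹ * ε) ≤ 1 := by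
    rw [← ENNReal.iSup_natCast, ENNReal.iSup_mul]
    exact iSup_le hle
  rw [ENNReal.top_mul hp] at htop
  exact absurd htop (by simp)

theorem modular_complementary_le_one {θ : ℝ≥0 → ℝ≥0∞} (hθ : IsGauge θ) (hfin : ∀ u, θ u ≠ ∞)
    (hθθ : complementary (complementary θ) = θ)
    {N : (H →L[ℂ] H) → ℝ≥0∞} (hN : IsModularNorm θ N)
    {L : orliczHeart H hθ →ₗ[ℂ] ℂ} {D : ℝ≥0} (hD : 0 < D) (hL : ∀ x, ‖L x‖ₑ ≤ D * N x)
    {y : H →L[ℂ] H} (hyc : IsCompactOperator y)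
    (hy : ∀ a b, L (rankOneHeart hθ hfin a b) = inner ℂ b (y a)) :
    modular (complementary θ) D⁻¹ y ≤ 1 := by
  obtain ⟨e, f, hs⟩ := exists_isSchmidt hyc
  rw [modular, ← tsum_singularValue_ne_zero y (g := fun t => complementary θ (D⁻¹ * t))
    (by simpa using (isGauge_complementary θ).map_zero), ENNReal.tsum_eq_iSup_sum]
  refine iSup_le fun F => ?_
  have h := sum_complementary_le_one hθ hfin hθθ hN hD hL hy (ι := F)
    (hs.left.comp _ Subtype.val_injective) (hs.right.comp _ Subtype.val_injective)
    (fun i => singularValue y i.1) fun i => hs.inner_apply_self i.1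
  rw [← Finset.sum_coe_sort]
  exact h

/-! ### Density of the operators of finite rank -/

theorem IsSchmidt.sub_sum {x : H →L[ℂ] H} {s : ι → ℝ≥0} {e f : ι → H} (h : IsSchmidt x s e f)
    (F : Finset ι) :
    IsSchmidt (x - ∑ i ∈ F, (s i : ℂ) • InnerProductSpace.rankOne ℂ (f i) (e i))
      (fun i : {i // i ∉ F} => s i) (fun i => e i) fun i => f i := by
  refine ⟨h.left.comp _ Subtype.val_injective, h.right.comp _ Subtype.val_injective, fun v => ?_⟩
  have h1 := (F.hasSum_compl_iff (f := fun i => ((s i : ℂ) * inner ℂ (e i) v) • f i)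
    (a := (x - ∑ i ∈ F, (s i : ℂ) • InnerProductSpace.rankOne ℂ (f i) (e i)) v)).2
  refine h1 ?_
  have h2 : (x - ∑ i ∈ F, (s i : ℂ) • InnerProductSpace.rankOne ℂ (f i) (e i)) v +
      ∑ i ∈ F, ((s i : ℂ) * inner ℂ (e i) v) • f i = x v := by
    simp only [sub_apply, sum_apply, smul_apply, InnerProductSpace.rankOne_apply, smul_smul,
      sub_add_cancel]
  rw [h2]
  exact h.hasSum v

/-- Since `Tr θ(c x)` is finite for every `c`, some tail of the Schmidt series, scaled by `c`, has
modular at most `1`. Hence `c * |L x| ≤ 2 C` for all `c`, where norm convergence of the series is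
never mentioned. -/
theorem eq_zero_of_rankOne_eq_zero {θ : ℝ≥0 → ℝ≥0∞} (hθ : IsGauge θ) (hfin : ∀ u, θ u ≠ ∞)
    (hθθ : complementary (complementary θ) = θ)
    {N : (H →L[ℂ] H) → ℝ≥0∞} (hN : IsModularNorm θ N)
    {L : orliczHeart H hθ →ₗ[ℂ] ℂ} (hL : L ∈ boundedDual (orliczHeart H hθ) N)
    (h : ∀ a b, L (rankOneHeart hθ hfin a b) = 0) : L = 0 := by
  obtain ⟨C, hC⟩ := hL
  ext x
  obtain ⟨e, f, hs⟩ := exists_isSchmidt x.2.1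
  have key : ∀ c : ℝ≥0, 0 < c → (c : ℝ≥0∞) * ‖L x‖ₑ ≤ C * (1 + 1) := by
    intro c hc
    have hsum : ∑' i : {n // singularValue (x : H →L[ℂ] H) n ≠ 0},
        θ (c * singularValue (x : H →L[ℂ] H) i) ≠ ∞ := by
      rw [tsum_singularValue_ne_zero (x : H →L[ℂ] H) (g := fun t => θ (c * t))
        (by simpa using hθ.map_zero)]
      exact (x.2.2 c hc).ne
    obtain ⟨F, hF⟩ := ((ENNReal.tendsto_tsum_compl_atTop_zero hsum).eventually
      (ge_mem_nhds one_pos)).exists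
    let z : orliczHeart H hθ := ∑ i ∈ F,
      ((singularValue (x : H →L[ℂ] H) i : ℝ≥0) : ℂ) • rankOneHeart hθ hfin (f i) (e i)
    have hz : (z : H →L[ℂ] H) = ∑ i ∈ F, ((singularValue (x : H →L[ℂ] H) i : ℝ≥0) : ℂ) •
        InnerProductSpace.rankOne ℂ (f i) (e i) := by
      simp [z, rankOneHeart]
    have hLz : L z = 0 := by simp [z, h]
    have hxz := hs.sub_sum F
    rw [← hz] at hxz
    have hc' : IsCompactOperator ((x : H →L[ℂ] H) - z : H →L[ℂ] H) := x.2.1.sub z.2.1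
    have h1 := hxz.modular_le hc' (complementary θ) c
    rw [hθθ] at h1
    have h2 := hC ((c : ℂ) • (x - z))
    rw [map_smul, map_sub, hLz, sub_zero, enorm_smul, enorm_coe_nnreal] at h2
    refine h2.trans (mul_le_mul_right ((hN.le_modular _ (hc'.smul (c : ℂ))).trans ?_) _)
    exact add_le_add_right ((modular_one_smul_le hθ hc' c).trans (h1.trans hF)) 1
  by_contra hne
  have htop : (∞ : ℝ≥0∞) * ‖L x‖ₑ ≤ C * (1 + 1) := by
    rw [← ENNReal.iSup_natCast, ENNReal.iSup_mul]
    refine iSup_le fun n => ?_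
    refine le_trans ?_ (key (n + 1) (by positivity))
    gcongr
    push_cast
    exact le_self_add
  rw [ENNReal.top_mul (by simpa using hne), ← ENNReal.coe_one, ← ENNReal.coe_add,
    ← ENNReal.coe_mul] at htop
  exact absurd (top_le_iff.1 htop) ENNReal.coe_ne_top

/-! ### The duality -/

/-- The common core of the two dualities. The last clause yields the hard inequality between the
Luxemburg norm of `y` and the norm of its functional. -/
theorem exists_linearEquiv_boundedDual {θ θ' : ℝ≥0 → ℝ≥0∞} (hθ : IsGauge θ) (hθ' : IsGauge θ')
    (hc : complementary θ = θ') (hc' : complementary θ' = θ) (hfin : ∀ u, θ u ≠ ∞)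
    (hpos : ∀ v, 0 < v → 0 < θ' v) {N : (H →L[ℂ] H) → ℝ≥0∞} (hN : IsModularNorm θ N)
    (htr : ∀ y ∈ orliczSpace H hθ', ∃ C : ℝ≥0, ∀ x ∈ orliczHeart H hθ, ∀ t,
      HasTrace (x * y) t → ‖t‖ₑ ≤ C * N x) :
    ∃ T : orliczSpace H hθ' ≃ₗ[ℂ] boundedDual (orliczHeart H hθ) N,
      (∀ (y : orliczSpace H hθ') (x : orliczHeart H hθ),
        HasTrace ((x : H →L[ℂ] H) * (y : H →L[ℂ] H)) ((T y).1 x)) ∧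
      (∀ L : boundedDual (orliczHeart H hθ) N, ∃! y : orliczSpace H hθ',
        ∀ x : orliczHeart H hθ, HasTrace ((x : H →L[ℂ] H) * (y : H →L[ℂ] H)) (L.1 x)) ∧
      ∀ (y : orliczSpace H hθ') (D : ℝ≥0), 0 < D → (∀ x, ‖(T y).1 x‖ₑ ≤ D * N x) →
        modular θ' D⁻¹ (y : H →L[ℂ] H) ≤ 1 := by
  subst hc
  have htc : ∀ (y : orliczSpace H hθ') (x : orliczHeart H hθ),
      IsTraceClass ((x : H →L[ℂ] H) * (y : H →L[ℂ] H)) := fun y x => isTraceClass_mul hθ x.2 y.2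
  choose τ hτ using fun (y : orliczSpace H hθ') (x : orliczHeart H hθ) =>
    (htc y x).exists_hasTrace
  let T₀ : orliczSpace H hθ' →ₗ[ℂ] orliczHeart H hθ →ₗ[ℂ] ℂ := LinearMap.mk₂ ℂ τ
    (fun y₁ y₂ x => (hτ _ x).unique (by
      have h := (hτ y₁ x).add (hτ y₂ x)
      rw [← mul_add] at h
      exact h (htc (y₁ + y₂) x)))
    (fun c y x => (hτ _ x).unique (by
      have h := (hτ y x).smul c
      rw [← mul_smul_comm] at h
      exact h (htc (c • y) x)))
    (fun y x₁ x₂ => (hτ y _).unique (by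
      have h := (hτ y x₁).add (hτ y x₂)
      rw [← add_mul] at h
      exact h (htc y (x₁ + x₂))))
    (fun c y x => (hτ y _).unique (by
      have h := (hτ y x).smul c
      rw [← smul_mul_assoc] at h
      exact h (htc y (c • x))))
  have hT₀ : ∀ y, T₀ y ∈ boundedDual (orliczHeart H hθ) N := fun y => by
    obtain ⟨C, hC⟩ := htr y y.2
    exact ⟨C, fun x => hC x x.2 _ (hτ y x)⟩
  let T₁ : orliczSpace H hθ' →ₗ[ℂ] boundedDual (orliczHeart H hθ) N := T₀.codRestrict _ hT₀
  have hT : ∀ (y : orliczSpace H hθ') (x : orliczHeart H hθ),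
      HasTrace ((x : H →L[ℂ] H) * (y : H →L[ℂ] H)) ((T₁ y).1 x) := hτ
  have hr : ∀ (y : orliczSpace H hθ') (a b : H),
      (T₁ y).1 (rankOneHeart hθ hfin a b) = inner ℂ b ((y : H →L[ℂ] H) a) := fun y a b =>
    HasTrace.rankOne_mul_eq (hT y (rankOneHeart hθ hfin a b))
  have hinj : Function.Injective T₁ := by
    intro y₁ y₂ h12
    ext a : 2
    refine ext_inner_left ℂ fun b => ?_
    rw [← hr, ← hr, h12]
  have hsurj : Function.Surjective T₁ := by
    intro L
    obtain ⟨y, hy⟩ := exists_rankOne_representation hθ hfin hN L.2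
    obtain ⟨C, hC⟩ := L.2
    -- The constant is made strictly positive, since `y` is going to be divided by it.
    have hC' : ∀ x, ‖L.1 x‖ₑ ≤ ((C + 1 : ℝ≥0) : ℝ≥0∞) * N x := fun x =>
      (hC x).trans (mul_le_mul_left (by exact_mod_cast le_self_add) _)
    have hD : (0 : ℝ≥0) < C + 1 := by positivity
    have hyc := isCompactOperator_of_bounded hθ hfin hc' hpos hN hD hC' hy
    have hym := modular_complementary_le_one hθ hfin hc' hN hD hC' hyc hy
    let Y : orliczSpace H hθ' :=
      ⟨y, hyc, (C + 1)⁻¹, inv_pos.2 hD, hym.trans_lt ENNReal.one_lt_top⟩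
    refine ⟨Y, ?_⟩
    have h0 := eq_zero_of_rankOne_eq_zero hθ hfin hc' hN (T₁ Y - L).2 fun a b => by
      change (T₁ Y).1 (rankOneHeart hθ hfin a b) - L.1 (rankOneHeart hθ hfin a b) = 0
      rw [hr, hy, sub_self]
    exact sub_eq_zero.1 (Subtype.ext h0)
  refine ⟨LinearEquiv.ofBijective T₁ ⟨hinj, hsurj⟩, hT, fun L => ?_, fun y D hD hy => ?_⟩
  · obtain ⟨y, rfl⟩ := hsurj L
    refine ⟨y, hT y, fun y' hy' => hinj (Subtype.ext (LinearMap.ext fun x => ?_))⟩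
    exact (hT y' x).unique (hy' x)
  · exact modular_complementary_le_one hθ hfin hc' hN hD hy y.2.1 (hr y)

end Duality

section Norms

variable {H : Type u} [NormedAddCommGroup H] [InnerProductSpace ℂ H] [CompleteSpace H]

/-! ### The Luxemburg norm -/

theorem luxemburgNorm_le {θ : ℝ≥0 → ℝ≥0∞} {x : H →L[ℂ] H} {c : ℝ≥0} (hc : 0 < c)
    (h : modular θ c⁻¹ x ≤ 1) : luxemburgNorm θ x ≤ c :=
  iInf_le_of_le c (iInf_le_of_le hc (iInf_le_of_le h le_rfl))

theorem le_mul_luxemburgNorm {θ : ℝ≥0 → ℝ≥0∞} {x : H →L[ℂ] H} {C s : ℝ≥0∞} (hC : C ≠ 0)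
    (hC' : C ≠ ∞) (h : ∀ c : ℝ≥0, 0 < c → modular θ c⁻¹ x ≤ 1 → s ≤ C * c) :
    s ≤ C * luxemburgNorm θ x := by
  simp only [luxemburgNorm, ENNReal.mul_iInf_of_ne hC hC']
  exact le_iInf fun c => le_iInf fun hc => le_iInf fun hcx => h c hc hcx

/-- The modular is at most `1` at every scale `c < 1`; each finite partial sum is continuous in `c`,
so the bound passes to `c = 1`. -/
theorem modular_le_one_of_luxemburgNorm_le_one {φ : ℝ≥0 → ℝ≥0∞} (hφ : IsOrliczFunction φ)
    {x : H →L[ℂ] H} (h : luxemburgNorm φ x ≤ 1) : modular φ 1 x ≤ 1 := by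
  have h1 : ∀ c : ℝ≥0, c < 1 → modular φ c x ≤ 1 := by
    intro c hc
    rcases eq_or_ne c 0 with rfl | hc0
    · simp [modular, hφ.map_zero]
    have h2 : luxemburgNorm φ x < ((c⁻¹ : ℝ≥0) : ℝ≥0∞) :=
      h.trans_lt (by exact_mod_cast (one_lt_inv₀ (pos_iff_ne_zero.2 hc0)).2 hc)
    simp only [luxemburgNorm, iInf_lt_iff] at h2
    obtain ⟨d, hd, hdx, hdc⟩ := h2
    refine (modular_mono hφ.isGauge ?_ x).trans hdx
    have hdc' : d < c⁻¹ := by exact_mod_cast hdc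
    exact (le_inv_comm₀ hd (pos_iff_ne_zero.2 hc0)).1 hdc'.le
  rw [modular, ENNReal.tsum_eq_iSup_sum]
  refine iSup_le fun F => ?_
  have hcont : Continuous fun c : ℝ≥0 => ∑ n ∈ F, φ (c * singularValue x n) :=
    continuous_finsetSum F fun n _ => hφ.continuous.comp (continuous_mul_const _)
  have hcl : IsClosed {c : ℝ≥0 | ∑ n ∈ F, φ (c * singularValue x n) ≤ 1} :=
    isClosed_le hcont continuous_const
  have hsub : Iio (1 : ℝ≥0) ⊆ {c : ℝ≥0 | ∑ n ∈ F, φ (c * singularValue x n) ≤ 1} :=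
    fun c hc => (ENNReal.sum_le_tsum F).trans (h1 c hc)
  have := hcl.closure_subset_iff.2 hsub
  rw [closure_Iio' ⟨0, one_pos⟩] at this
  exact this (mem_Iic.2 le_rfl)

theorem isModularNorm_luxemburgNorm {θ : ℝ≥0 → ℝ≥0∞} (hθ : IsGauge θ)
    (hθθ : complementary (complementary θ) = θ) :
    IsModularNorm θ (luxemburgNorm θ : (H →L[ℂ] H) → ℝ≥0∞) where
  smul_le x hx a := by
    rcases eq_or_ne a 0 with rfl | ha
    · have h0 : luxemburgNorm θ (0 : H →L[ℂ] H) ≤ 0 :=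
        ENNReal.le_of_forall_pos_le_add fun ε hε _ => by
          rw [zero_add]
          exact luxemburgNorm_le hε (by rw [modular_zero hθ]; exact zero_le)
      rw [zero_smul]
      exact h0.trans zero_le
    · refine le_mul_luxemburgNorm (by simpa using ha) enorm_ne_top fun c hc hcx => ?_
      have ha' : 0 < ‖a‖₊ := nnnorm_pos.2 ha
      rw [enorm_eq_nnnorm, ← ENNReal.coe_mul]
      refine luxemburgNorm_le (mul_pos ha' hc) ((modular_smul_le hθ hx a _).trans ?_)
      have : (‖a‖₊ * c)⁻¹ * ‖a‖₊ = c⁻¹ := by field_simp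
      rwa [this]
  le_modular x hx := by
    by_cases hM : modular θ 1 x = ∞
    · simp [hM]
    obtain ⟨M, hM'⟩ := ENNReal.canLift.prf _ hM
    -- The competitor in the infimum is `1 + M`, with `M` the modular of `x`.
    have h := modular_inv_le_one (complementary θ) (c := 1) (M := M) (x := x)
      (by rw [hθθ, hM'])
    rw [hθθ, mul_one] at h
    rw [← hM']
    exact_mod_cast luxemburgNorm_le (by positivity) h

/-! ### The Orlicz norm -/

theorem traceNorm_le_orliczNorm {θ : ℝ≥0 → ℝ≥0∞} (x : H →L[ℂ] H) {y : H →L[ℂ] H}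
    (hy : IsCompactOperator y) (h : modular (complementary θ) 1 y ≤ 1) :
    traceNorm (x * y) ≤ orliczNorm θ x :=
  le_iSup_of_le y (le_iSup_of_le hy (le_iSup_of_le h le_rfl))

theorem traceNorm_mul_le_orliczNorm {θ : ℝ≥0 → ℝ≥0∞} {x y : H →L[ℂ] H}
    (hy : IsCompactOperator y) {c : ℝ≥0} (hc : 0 < c)
    (h : modular (complementary θ) c⁻¹ y ≤ 1) : traceNorm (x * y) ≤ c * orliczNorm θ x := by
  have hc' : (c : ℂ) ≠ 0 := by simpa using hc.ne'
  have hxy : x * y = (c : ℂ) • (x * (((c⁻¹ : ℝ≥0) : ℂ) • y)) := by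
    rw [mul_smul_comm, smul_smul]
    simp [hc']
  have hy' : IsCompactOperator (((c⁻¹ : ℝ≥0) : ℂ) • y : H →L[ℂ] H) := hy.smul _
  rw [hxy]
  refine (traceNorm_smul_le (hy'.clm_comp x) _).trans ?_
  rw [enorm_coe_nnreal]
  exact mul_le_mul_right (traceNorm_le_orliczNorm x hy'
    ((modular_one_smul_le (isGauge_complementary θ) hy _).trans h)) _

theorem isModularNorm_orliczNorm {θ : ℝ≥0 → ℝ≥0∞} (hθ : IsGauge θ) :
    IsModularNorm θ (orliczNorm θ : (H →L[ℂ] H) → ℝ≥0∞) where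
  smul_le x hx a := by
    refine iSup_le fun y => iSup_le fun hy => iSup_le fun hyθ => ?_
    rw [smul_mul_assoc]
    exact (traceNorm_smul_le (hx.comp_clm y) a).trans
      (mul_le_mul_right (traceNorm_le_orliczNorm x hy hyθ) _)
  le_modular x hx := by
    refine iSup_le fun y => iSup_le fun hy => iSup_le fun hyθ => ?_
    rw [add_comm]
    exact (traceNorm_mul_le hx hy hθ).trans (add_le_add_right hyθ _)

/-! ### Dual norms -/

theorem enorm_le_dualNorm {E : Submodule ℂ (H →L[ℂ] H)} {N : (H →L[ℂ] H) → ℝ≥0∞} (L : E →ₗ[ℂ] ℂ)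
    {x : E} (hx : N x ≤ 1) : ‖L x‖ₑ ≤ dualNorm N L :=
  le_iSup₂ (f := fun (x : E) (_ : N x ≤ 1) => ‖L x‖ₑ) x hx

theorem IsModularNorm.enorm_le_of_dualNorm_le {θ : ℝ≥0 → ℝ≥0∞} {hθ : IsGauge θ}
    {N : (H →L[ℂ] H) → ℝ≥0∞} (hN : IsModularNorm θ N) {L : orliczHeart H hθ →ₗ[ℂ] ℂ} {D : ℝ≥0}
    (hD : 0 < D) (h : dualNorm N L ≤ D) (x : orliczHeart H hθ) : ‖L x‖ₑ ≤ D * N x := by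
  by_cases hx : N x = ∞
  · rw [hx, ENNReal.mul_top (by simpa using hD.ne')]
    exact le_top
  obtain ⟨r, hr⟩ := ENNReal.canLift.prf _ hx
  rw [← hr]
  refine ENNReal.le_of_forall_pos_le_add fun ε hε _ => ?_
  -- Positive even if `N x = 0`, and chosen so that `D * δ = D * r + ε`.
  set δ : ℝ≥0 := r + D⁻¹ * ε with hδ
  have hδ0 : 0 < δ := add_pos_of_nonneg_of_pos zero_le (mul_pos (inv_pos.2 hD) hε)
  have h1 : N ((((δ⁻¹ : ℝ≥0) : ℂ) • x : orliczHeart H hθ) : H →L[ℂ] H) ≤ 1 := by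
    refine (hN.smul_le x x.2.1 _).trans ?_
    rw [enorm_coe_nnreal, ← hr, ← ENNReal.coe_mul]
    have : δ⁻¹ * r ≤ 1 := by
      rw [inv_mul_le_iff₀ hδ0, mul_one]
      exact le_self_add
    exact_mod_cast this
  have h2 : ‖L (((δ⁻¹ : ℝ≥0) : ℂ) • x)‖ₑ ≤ D :=
    (enorm_le_dualNorm L h1).trans h
  rw [map_smul, enorm_smul, enorm_coe_nnreal, enorm_eq_nnnorm, ← ENNReal.coe_mul,
    ENNReal.coe_le_coe, inv_mul_le_iff₀ hδ0] at h2
  rw [enorm_eq_nnnorm]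
  have h3 : ‖L x‖₊ ≤ D * r + ε := by
    refine h2.trans (le_of_eq ?_)
    rw [hδ]
    field_simp
  exact_mod_cast h3

/-- An operator `x` competing in the Orlicz norm need not lie in `E_φ`. It is therefore replaced by
the finite rank operator `z = x u`, with `u` a partial isometry built from the Schmidt vectors of `y
x`: its modular is no larger, and `Tr (z y)` is a partial sum of `Tr |yx|`. -/
theorem dualNorm_luxemburgNorm {φ : ℝ≥0 → ℝ≥0∞} (hφ : IsOrliczFunction φ) (hfin : ∀ u, φ u ≠ ∞)
    {y : H →L[ℂ] H} {L : orliczHeart H hφ.isGauge →ₗ[ℂ] ℂ}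
    (hL : ∀ x : orliczHeart H hφ.isGauge, HasTrace ((x : H →L[ℂ] H) * y) (L x)) :
    dualNorm (luxemburgNorm φ) L = orliczNorm (complementary φ) y := by
  refine le_antisymm (iSup_le fun x => iSup_le fun hx => ?_)
    (iSup_le fun x => iSup_le fun hx => iSup_le fun hxφ => ?_)
  · refine (HasTrace.enorm_le_traceNorm_swap x.2.1 (hL x)).trans
      (traceNorm_le_orliczNorm y x.2.1 ?_)
    rw [hφ.complementary_complementary]
    exact modular_le_one_of_luxemburgNorm_le_one hφ hx
  · rw [hφ.complementary_complementary] at hxφ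
    obtain ⟨e, f, hs⟩ := exists_isSchmidt (x := y * x) (hx.clm_comp y)
    rw [traceNorm, ← tsum_singularValue_ne_zero (y * x) (g := fun t => (t : ℝ≥0∞)) rfl,
      ENNReal.tsum_eq_iSup_sum]
    refine iSup_le fun F => ?_
    let z : orliczHeart H hφ.isGauge := ∑ i ∈ F, rankOneHeart hφ.isGauge hfin (x (e i)) (f i)
    have hz : (z : H →L[ℂ] H) = x * ∑ i ∈ F, InnerProductSpace.rankOne ℂ (e i) (f i) := by
      ext v
      simp [z, rankOneHeart, mul_apply_eq_comp]
    have hLz : L z = ((∑ i ∈ F, singularValue (y * x) i : ℝ≥0) : ℂ) := by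
      simp only [z, map_sum]
      push_cast
      refine Finset.sum_congr rfl fun i _ => ?_
      rw [HasTrace.rankOne_mul_eq (hL (rankOneHeart hφ.isGauge hfin (x (e i)) (f i)))]
      exact hs.inner_apply_self i
    have hNz : luxemburgNorm φ (z : H →L[ℂ] H) ≤ 1 := by
      refine luxemburgNorm_le (c := 1) one_pos ?_
      rw [inv_one, hz]
      exact (modular_comp_le hφ.isGauge hx (norm_sum_rankOne_le hs.left hs.right F) 1).trans hxφ
    have h : ‖L z‖ₑ ≤ dualNorm (luxemburgNorm φ) L := enorm_le_dualNorm L hNz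
    rw [hLz, enorm_coe_nnreal] at h
    exact_mod_cast h

theorem exists_enorm_le_mul_luxemburgNorm {θ : ℝ≥0 → ℝ≥0∞} (hθ : IsGauge θ) {y : H →L[ℂ] H}
    (hy : y ∈ orliczSpace H (isGauge_complementary θ)) :
    ∃ C : ℝ≥0, ∀ x ∈ orliczHeart H hθ, ∀ t, HasTrace (x * y) t → ‖t‖ₑ ≤ C * luxemburgNorm θ x := by
  obtain ⟨hyc, c, hc, hcy⟩ := hy
  obtain ⟨M, hM⟩ := ENNReal.canLift.prf _ hcy.ne
  refine ⟨c⁻¹ * (1 + M), fun x hx t ht => ?_⟩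
  have hC : c⁻¹ * (1 + M) ≠ 0 := by positivity
  refine le_mul_luxemburgNorm (by exact_mod_cast hC) ENNReal.coe_ne_top fun d hd hdx => ?_
  refine ht.enorm_le.trans ((traceNorm_mul_le_modular hx.1 hyc hθ hc hd).trans ?_)
  rw [← hM]
  refine (mul_le_mul_right (add_le_add_left hdx _) _).trans (le_of_eq ?_)
  push_cast
  ring

theorem exists_enorm_le_mul_orliczNorm {θ : ℝ≥0 → ℝ≥0∞} (hθ : IsGauge θ) {y : H →L[ℂ] H}
    (hy : y ∈ orliczSpace H (isGauge_complementary θ)) :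
    ∃ C : ℝ≥0, ∀ x ∈ orliczHeart H hθ, ∀ t, HasTrace (x * y) t → ‖t‖ₑ ≤ C * orliczNorm θ x := by
  obtain ⟨hyc, c, hc, hcy⟩ := hy
  obtain ⟨M, hM⟩ := ENNReal.canLift.prf _ hcy.ne
  refine ⟨((1 + M)⁻¹ * c)⁻¹, fun x hx t ht => ht.enorm_le.trans
    (traceNorm_mul_le_orliczNorm hyc (by positivity) ?_)⟩
  rw [inv_inv]
  exact modular_inv_le_one θ hM.ge

end Norms

end OperatorOrlicz

/-! ### The two dualities. -/

theorem theorem3p4 {H : Type u} [NormedAddCommGroup H] [InnerProductSpace ℂ H] [CompleteSpace H]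
    [TopologicalSpace.SeparableSpace H]
    (φ : ℝ≥0 → ℝ≥0∞) (hφ : OperatorOrlicz.IsOrliczFunction φ) :
    -- `S_ψ` with the Orlicz norm is the dual of `E_φ` with the Luxemburg norm
    ((∀ u, φ u ≠ ∞) → (∀ v, 0 < v → 0 < OperatorOrlicz.complementary φ v) →
      ∃ T : OperatorOrlicz.orliczSpace H (OperatorOrlicz.isGauge_complementary φ) ≃ₗ[ℂ]
          OperatorOrlicz.boundedDual (OperatorOrlicz.orliczHeart H hφ.isGauge)
            (OperatorOrlicz.luxemburgNorm φ),
        (∀ (y : OperatorOrlicz.orliczSpace H (OperatorOrlicz.isGauge_complementary φ))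
            (x : OperatorOrlicz.orliczHeart H hφ.isGauge),
          OperatorOrlicz.HasTrace ((x : H →L[ℂ] H) * (y : H →L[ℂ] H)) ((T y).1 x)) ∧
        (∀ y, OperatorOrlicz.dualNorm (OperatorOrlicz.luxemburgNorm φ) (T y).1 =
          OperatorOrlicz.orliczNorm (OperatorOrlicz.complementary φ) (y : H →L[ℂ] H)) ∧
        ∀ L : OperatorOrlicz.boundedDual (OperatorOrlicz.orliczHeart H hφ.isGauge)
            (OperatorOrlicz.luxemburgNorm φ),
          ∃! y : OperatorOrlicz.orliczSpace H (OperatorOrlicz.isGauge_complementary φ),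
            ∀ x : OperatorOrlicz.orliczHeart H hφ.isGauge,
              OperatorOrlicz.HasTrace ((x : H →L[ℂ] H) * (y : H →L[ℂ] H)) (L.1 x)) ∧
    -- `S_φ` with the Luxemburg norm is the dual of `E_ψ` with the Orlicz norm
    ((∀ v, OperatorOrlicz.complementary φ v ≠ ∞) →
      ∃ T : OperatorOrlicz.orliczSpace H hφ.isGauge ≃ₗ[ℂ]
          OperatorOrlicz.boundedDual
            (OperatorOrlicz.orliczHeart H (OperatorOrlicz.isGauge_complementary φ))
            (OperatorOrlicz.orliczNorm (OperatorOrlicz.complementary φ)),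
        (∀ (y : OperatorOrlicz.orliczSpace H hφ.isGauge)
            (x : OperatorOrlicz.orliczHeart H (OperatorOrlicz.isGauge_complementary φ)),
          OperatorOrlicz.HasTrace ((x : H →L[ℂ] H) * (y : H →L[ℂ] H)) ((T y).1 x)) ∧
        (∀ y, OperatorOrlicz.dualNorm
            (OperatorOrlicz.orliczNorm (OperatorOrlicz.complementary φ)) (T y).1 =
          OperatorOrlicz.luxemburgNorm φ (y : H →L[ℂ] H)) ∧
        ∀ L : OperatorOrlicz.boundedDual
            (OperatorOrlicz.orliczHeart H (OperatorOrlicz.isGauge_complementary φ))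
            (OperatorOrlicz.orliczNorm (OperatorOrlicz.complementary φ)),
          ∃! y : OperatorOrlicz.orliczSpace H hφ.isGauge,
            ∀ x : OperatorOrlicz.orliczHeart H (OperatorOrlicz.isGauge_complementary φ),
              OperatorOrlicz.HasTrace ((x : H →L[ℂ] H) * (y : H →L[ℂ] H)) (L.1 x)) := by
  have hψ := OperatorOrlicz.isGauge_complementary φ
  have hφφ := hφ.complementary_complementary
  refine ⟨fun hfin hpos => ?_, fun hfin => ?_⟩
  · obtain ⟨T, hT, hu, -⟩ := OperatorOrlicz.exists_linearEquiv_boundedDual (H := H) hφ.isGauge hψ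
      rfl hφφ hfin hpos (OperatorOrlicz.isModularNorm_luxemburgNorm hφ.isGauge hφφ)
      fun y hy => OperatorOrlicz.exists_enorm_le_mul_luxemburgNorm hφ.isGauge hy
    exact ⟨T, hT, fun y => OperatorOrlicz.dualNorm_luxemburgNorm hφ hfin (hT y), hu⟩
  · have hN := OperatorOrlicz.isModularNorm_orliczNorm (H := H) hψ
    -- The roles are exchanged: `θ = ψ` and `θ' = φ`, so the positivity required is that of `φ`
    -- itself.
    obtain ⟨T, hT, hu, hD⟩ := OperatorOrlicz.exists_linearEquiv_boundedDual (H := H) hψ hφ.isGauge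
      hφφ rfl hfin hφ.pos hN fun y hy => by
        refine OperatorOrlicz.exists_enorm_le_mul_orliczNorm hψ ?_
        obtain ⟨h1, h2⟩ := hy
        refine ⟨h1, ?_⟩
        rwa [hφφ]
    refine ⟨T, hT, fun y => le_antisymm (iSup_le fun x => iSup_le fun hx => ?_) ?_, hu⟩
    · refine le_iInf fun c => le_iInf fun hc => le_iInf fun hcy => (hT y x).enorm_le.trans ?_
      refine (OperatorOrlicz.traceNorm_mul_le_orliczNorm y.2.1 hc (by rwa [hφφ])).trans ?_
      exact (mul_le_mul_right hx _).trans (mul_one _).le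
    -- The dual norm may be `0`, whereas `hD` needs a positive bound; hence `D + ε`.
    · refine ENNReal.le_of_forall_pos_le_add fun ε hε hfinite => ?_
      obtain ⟨D, hD'⟩ := ENNReal.canLift.prf _ hfinite.ne
      have hpos : 0 < D + ε := add_pos_of_nonneg_of_pos zero_le hε
      rw [← hD', ← ENNReal.coe_add]
      refine OperatorOrlicz.luxemburgNorm_le hpos (hD y _ hpos fun x => ?_)
      refine hN.enorm_le_of_dualNorm_le hpos ?_ x
      rw [← hD']
      exact_mod_cast le_self_add
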